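/- Let $(\Omega,\mathcal F,\mu)$ be a measure space with an increasing family $(\mathcal F_i)_{i\in\mathbb Z}$ of sub-$\sigma$-algebras of $\mathcal F$ such that $\mu$ is $\sigma$-finite on every $\mathcal F_i$. Let $\mathcal F_i^0$ be the collection of sets $E\in\mathcal F_i$ with $\mu(E)<\infty$, and let $\mathcal L^+$ be the set of nonnegative $\mathcal F$-measurable real functions that are integrable over every $E\in\mathcal F_i^0$, for every $i\in\mathbb Z$. If $f$ is integrable over all sets of $\mathcal F_i^0$, then $\mathcal E_if=E[f|\mathcal F_i]$ denotes its conditional expectation: the a.e. unique $\mathcal F_i$-measurable function that is integrable over all $G\in\mathcal F_i^0$ and satisfies $\int_G\mathcal E_if\,d\mu=\int_Gf\,d\mu$ for all $G\in\mathcal F_i^0$. For $i\in\mathbb Z$ let $\alpha_i$ be a nonnegative bounded $\mathcal F_i$-measurable function, put $\overline\alpha_i:=\sum_{j\ge i}\alpha_j$ and assume that $\overline\alpha_i\in\mathcal L^+$ for every $i$ (in particular the sum converges a.e.) and that there is a constant $\kappa>0$ with $$\kappa^{-1}\,\overline\alpha_i\le\mathcal E_i\overline\alpha_i\le\kappa\,\overline\alpha_i\quad\text{a.e.,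 for every } i\in\mathbb Z.$$ Let $T_\alpha f:=\sum_{i\in\mathbb Z}\alpha_i\,\mathcal E_if$, let $w\in\mathcal L^+$, write $[w\,d\mu](E)=\int_Ew\,d\mu$, let $1<p\le q<\infty$, and put $p'=p/(p-1)$, $q'=q/(q-1)$. Then the following statements are equivalent: (a) There is a constant $C_1>0$ such that, for every real-valued $f\in L^p(d\mu)$, the series defining $T_\alpha f$ converges absolutely $w\,d\mu$-almost everywhere and $$\|T_\alpha f\|_{L^q(w\,d\mu)}\le C_1\|f\|_{L^p(d\mu)}.$$ (b) There is a constant $C_2>0$ such that, for every $i\in\mathbb Z$ and every $E\in\mathcal F_i^0$, $$\Bigl(\int_E\Bigl(\sum_{j\ge i}\alpha_j\,\mathcal E_jw\Bigr)^{p'}d\mu\Bigr)^{1/p'}\le C_2\,[w\,d\mu](E)^{1/q'}.$$ Moreover, the least possible constants $C_1$ and $C_2$ (understood as infima, $+\infty$ if no constant exists) are comparable: there is a constant $K>0$, depending only on $p$, $q$ and $\kappa$, such that each of them is at most $K$ times the other. -/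

import Mathlib

open MeasureTheory
open scoped ENNReal

namespace FilteredMeasure

variable {Ω : Type*}

/-- `g` is a version of the conditional expectation `E[f | m]` on a (possibly infinite) measure
space: it is `m`-measurable, integrable over all `m`-measurable sets of finite measure, and has
the same integrals as `f` over these sets. -/
structure IsCondExp {m0 : MeasurableSpace Ω} (m : MeasurableSpace Ω) (μ : Measure[m0] Ω)
    (f g : Ω → ℝ) : Prop where
  measurable : Measurable[m] g
  integrableOn : ∀ G, MeasurableSet[m] G → μ G < ∞ → IntegrableOn g G μ
  setIntegral_eq : ∀ G, MeasurableSet[m] G → μ G < ∞ → ∫ x in G, g x ∂μ = ∫ x in G, f x ∂μ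

/-- Existence of the conditional expectation of a function that is integrable over all
`m`-measurable sets of finite measure. -/
theorem exists_isCondExp {m m0 : MeasurableSpace Ω} (hm : m ≤ m0) (μ : Measure[m0] Ω)
    [SigmaFinite (μ.trim hm)] {f : Ω → ℝ}
    (hf : ∀ G, MeasurableSet[m] G → μ G < ∞ → IntegrableOn f G μ) :
    ∃ g, IsCondExp m μ f g := by
  have key : ∀ u : Ω → ℝ, ∀ G, MeasurableSet[m] G → IntegrableOn u G μ →
      IntegrableOn (fun x => (condLExp m μ (fun y => ENNReal.ofReal (u y)) x).toReal) G μ ∧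
      ∫ x in G, (condLExp m μ (fun y => ENNReal.ofReal (u y)) x).toReal ∂μ
        = (∫⁻ x in G, ENNReal.ofReal (u x) ∂μ).toReal := by
    intro u G hG hu
    have hmeas : AEMeasurable (condLExp m μ (fun y => ENNReal.ofReal (u y))) (μ.restrict G) :=
      ((measurable_condLExp m μ _).mono hm le_rfl).aemeasurable
    have hfin : ∫⁻ x in G, condLExp m μ (fun y => ENNReal.ofReal (u y)) x ∂μ ≠ ∞ := by
      rw [setLIntegral_condLExp hm μ _ hG]
      exact (hu.lintegral_lt_top).ne
    refine ⟨integrable_toReal_of_lintegral_ne_top hmeas hfin, ?_⟩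
    rw [integral_toReal hmeas (ae_lt_top' hmeas hfin), setLIntegral_condLExp hm μ _ hG]
  refine ⟨fun x => (condLExp m μ (fun y => ENNReal.ofReal (f y)) x).toReal
    - (condLExp m μ (fun y => ENNReal.ofReal (-f y)) x).toReal, ?_, ?_, ?_⟩
  · exact (measurable_condLExp m μ _).ennreal_toReal.sub (measurable_condLExp m μ _).ennreal_toReal
  · intro G hG hμ
    exact (key f G hG (hf G hG hμ)).1.sub (key (fun x => -f x) G hG (hf G hG hμ).neg).1
  · intro G hG hμ
    have h1 := key f G hG (hf G hG hμ)
    have h2 := key (fun x => -f x) G hG (hf G hG hμ).neg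
    rw [integral_sub h1.1 h2.1, h1.2, h2.2,
      integral_eq_lintegral_pos_part_sub_lintegral_neg_part (hf G hG hμ)]

open Classical in
/-- The conditional expectation `E[f | m]` (a version of it; `0` if there is none). -/
noncomputable def cExp {m0 : MeasurableSpace Ω} (m : MeasurableSpace Ω) (μ : Measure[m0] Ω)
    (f : Ω → ℝ) : Ω → ℝ :=
  if h : ∃ g, IsCondExp m μ f g then h.choose else 0

/-- The defining property of the conditional expectation. -/
theorem isCondExp_cExp {m m0 : MeasurableSpace Ω} (hm : m ≤ m0) (μ : Measure[m0] Ω)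
    [SigmaFinite (μ.trim hm)] {f : Ω → ℝ}
    (hf : ∀ G, MeasurableSet[m] G → μ G < ∞ → IntegrableOn f G μ) :
    IsCondExp m μ f (cExp m μ f) := by
  have h := exists_isCondExp hm μ hf
  rw [cExp, dif_pos h]
  exact h.choose_spec

variable [m0 : MeasurableSpace Ω]

/-- The class `𝓛⁺` of weights: nonnegative functions that are integrable over every set of finite
measure belonging to one of the σ-algebras of the filtration. -/
structure IsWeight (μ : Measure Ω) (ℱ : Filtration ℤ m0) (w : Ω → ℝ) : Prop where
  aestronglyMeasurable : AEStronglyMeasurable w μ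
  nonneg : 0 ≤ᵐ[μ] w
  integrableOn : ∀ i, ∀ E, MeasurableSet[ℱ i] E → μ E < ∞ → IntegrableOn w E μ

/-- The measure `w dμ`. -/
noncomputable def weighted (μ : Measure Ω) (w : Ω → ℝ) : Measure Ω :=
  μ.withDensity fun x => ENNReal.ofReal (w x)

/-- The tail sums `∑_{j ≥ i} α_j`. -/
noncomputable def tailSum (α : ℤ → Ω → ℝ) (i : ℤ) (x : Ω) : ℝ :=
  ∑' j : Set.Ici i, α (j : ℤ) x

/-- The standing condition on the coefficients `α`: each `α_i` is nonnegative, bounded and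
`ℱ_i`-measurable, the tail sums `∑_{j ≥ i} α_j` converge and belong to `𝓛⁺`, and they are
comparable, with the constant `κ`, to their conditional expectations given `ℱ_i`. -/
structure TailCondition (μ : Measure Ω) (ℱ : Filtration ℤ m0) (α : ℤ → Ω → ℝ) (κ : ℝ) :
    Prop where
  measurable : ∀ i, Measurable[ℱ i] (α i)
  nonneg : ∀ i x, 0 ≤ α i x
  bounded : ∀ i, ∃ M, ∀ x, α i x ≤ M
  summable : ∀ i : ℤ, ∀ᵐ x ∂μ, Summable fun j : Set.Ici i => α (j : ℤ) x
  isWeight : ∀ i, IsWeight μ ℱ (tailSum α i)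
  lower : ∀ i, ∀ᵐ x ∂μ, κ⁻¹ * tailSum α i x ≤ cExp (ℱ i) μ (tailSum α i) x
  upper : ∀ i, ∀ᵐ x ∂μ, cExp (ℱ i) μ (tailSum α i) x ≤ κ * tailSum α i x

/-- The positive operator `T_α f = ∑_{i ∈ ℤ} α_i E_i f`. -/
noncomputable def posOp (μ : Measure Ω) (ℱ : Filtration ℤ m0) (α : ℤ → Ω → ℝ) (f : Ω → ℝ)
    (x : Ω) : ℝ :=
  ∑' i : ℤ, α i x * cExp (ℱ i) μ f x

/-- The trace inequality `‖T_α f‖_{L^q(w dμ)} ≤ C ‖f‖_{L^p(dμ)}` for all `f ∈ L^p(dμ)`, including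
that the series defining `T_α f` converges `w dμ`-almost everywhere. -/
def TraceInequality (μ : Measure Ω) (ℱ : Filtration ℤ m0) (α : ℤ → Ω → ℝ) (w : Ω → ℝ)
    (p q C : ℝ) : Prop :=
  ∀ f : Ω → ℝ, MemLp f (ENNReal.ofReal p) μ →
    (∀ᵐ x ∂(weighted μ w), Summable fun i : ℤ => α i x * cExp (ℱ i) μ f x) ∧
    eLpNorm (posOp μ ℱ α f) (ENNReal.ofReal q) (weighted μ w)
      ≤ ENNReal.ofReal C * eLpNorm f (ENNReal.ofReal p) μ

/-- The Sawyer-type testing condition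
`(∫_E (∑_{j ≥ i} α_j E_j w)^{p'} dμ)^{1/p'} ≤ C (∫_E w dμ)^{1/q'}` for all `i` and all `E ∈ ℱ_i`
of finite measure; both sides are computed in `[0, ∞]`. -/
def TestingCondition (μ : Measure Ω) (ℱ : Filtration ℤ m0) (α : ℤ → Ω → ℝ) (w : Ω → ℝ)
    (p q C : ℝ) : Prop :=
  ∀ (i : ℤ) (E : Set Ω), MeasurableSet[ℱ i] E → μ E < ∞ →
    (∫⁻ x in E, (∑' j : Set.Ici i, ENNReal.ofReal (α (j : ℤ) x * cExp (ℱ (j : ℤ)) μ w x))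
        ^ p.conjExponent ∂μ) ^ (1 / p.conjExponent)
      ≤ ENNReal.ofReal C * (weighted μ w E) ^ (1 / q.conjExponent)

/-- The least possible constant (infimum, `∞` if there is none) in an inequality `P C`. -/
noncomputable def leastConst (P : ℝ → Prop) : ℝ≥0∞ :=
  ⨅ (C : ℝ) (_ : 0 < C ∧ P C), ENNReal.ofReal C

end FilteredMeasure

open FilteredMeasure

/-! The trace inequality is a two-sided bilinear estimate, and everything is carried out for
`[0, ∞]`-valued functions, where conditional expectations (`condLExp`) exist without any
integrability. Write `E_i` for the conditional expectations with respect to `μ`.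

*Necessity of the testing condition* is duality (`TraceInequality.testingCondition`): pairing
`1_E ∑_{j ≥ i} α_j E_j w` with `g` and moving the self-adjoint operators `E_j` to the other side
gives at most the integral of `T_α (1_E g)` over `E` with respect to `w dμ`, which Hölder's
inequality and the trace inequality bound with the same constant.

*Sufficiency* is proved for the sums over `j ≥ i`, uniformly in `i`
(`lintegral_tsum_mul_withDensity_le`), and has three ingredients. Let
`β_i = E_i (∑_{j ≥ i} α_j)`, an adapted sequence comparable to the tail sums.

* `lintegral_tsum_mul_condLExp_le`: in `∑_i ∫ α_i (E_i f) (E_i h) dμ` replace `E_i f` by the running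
  maximum `F_i` and sum by parts. The tails `∑_{i ≥ j} α_i` appear next to the increments of `F`,
  they are at most `κ β_j`, and one obtains the bound `κ ∫ sup_j (β_j E_j h) sup_j (E_j f) dμ`. By
  Hölder's and Doob's inequalities it remains to bound the maximal operator
  `sup_j β_j E_j (g w)` from `L^{q'}(w dμ)` to `L^{p'}(dμ)`.
* `setLIntegral_iSup_mul_condLExp_rpow_le`: since `β_j E_j w` is at most `κ` times the conditional
  expectation given `ℱ_j` of `∑_{k ≥ i} α_k E_k w` for `j ≥ i`, Doob's inequality turns the testing
  condition into the testing condition for the maximal operator.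
* `lintegral_iSup_mul_rpow_le`: Sawyer's argument. By Bayes' formula `E_j (g w)` is the product
  of `E_j w` and of the conditional expectation of `g` with respect to `w dμ`. The level sets of
  the latter at the heights `2^k` are cut according to the first passage time, the testing
  condition is applied to each piece, the sum is controlled by the inclusion of `ℓ^1` in
  `ℓ^{p'/q'}` (this is where `p ≤ q` enters), and Doob's inequality for the measure `w dμ`
  (`lintegral_iSup_condLExp_rpow_le`) concludes.

The duality `lintegral_rpow_le_of_forall_pairing` converts the bilinear bound into the trace
inequality; finiteness of the resulting norm also gives the absolute convergence of the series.
-/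

namespace FilteredMeasure

variable {Ω : Type*}

/-! ### Conditional expectations of nonnegative functions -/

section CondLExp

variable {m m0 : MeasurableSpace Ω}

/-- The conditional expectation is self-adjoint: it may be dropped against an `m`-measurable
factor. -/
theorem lintegral_mul_condLExp (hm : m ≤ m0) (μ : Measure Ω) [SigmaFinite (μ.trim hm)]
    {y X : Ω → ℝ≥0∞} (hy : Measurable[m] y) (hX : Measurable X) :
    ∫⁻ x, y x * condLExp m μ X x ∂μ = ∫⁻ x, y x * X x ∂μ := by
  have hE : Measurable (condLExp m μ X) := (measurable_condLExp m μ X).mono hm le_rfl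
  have key : (μ.withDensity (condLExp m μ X)).trim hm = (μ.withDensity X).trim hm := by
    refine @Measure.ext _ m _ _ fun s hs => ?_
    rw [trim_measurableSet_eq hm hs, trim_measurableSet_eq hm hs, withDensity_apply _ (hm s hs),
      withDensity_apply _ (hm s hs), setLIntegral_condLExp hm μ X hs]
  have h1 := lintegral_withDensity_eq_lintegral_mul μ hE (hy.mono hm le_rfl)
  have h2 := lintegral_withDensity_eq_lintegral_mul μ hX (hy.mono hm le_rfl)
  rw [← lintegral_trim hm hy, key, lintegral_trim hm hy] at h1
  simp only [Pi.mul_apply, mul_comm _ (y _)] at h1 h2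
  rw [← h1, h2]

/-- An `m`-measurable factor may be pulled out of the conditional expectation. -/
theorem condLExp_mul_left (hm : m ≤ m0) (μ : Measure Ω) [SigmaFinite (μ.trim hm)]
    {y X : Ω → ℝ≥0∞} (hy : Measurable[m] y) (hX : Measurable X) :
    (fun x => y x * condLExp m μ X x) =ᵐ[μ] condLExp m μ (fun x => y x * X x) := by
  refine ae_eq_condLExp hm μ _ (hy.mul (measurable_condLExp m μ X)) fun s hs => ?_
  have h := lintegral_mul_condLExp hm μ (y := s.indicator y) (hy.indicator hs) hX
  simp_rw [← Set.indicator_mul_left] at h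
  rwa [lintegral_indicator (hm s hs), lintegral_indicator (hm s hs)] at h

/-- Conditional expectations with respect to `μ` and to `W μ` are related by Bayes' formula
`E_μ[W g | m] = E_{Wμ}[g | m] E_μ[W | m]`. -/
theorem condLExp_withDensity_mul (hm : m ≤ m0) (μ : Measure Ω) [SigmaFinite (μ.trim hm)]
    {W g : Ω → ℝ≥0∞} (hW : Measurable W) (hg : Measurable g)
    [SigmaFinite ((μ.withDensity W).trim hm)] :
    (fun x => condLExp m (μ.withDensity W) g x * condLExp m μ W x)
      =ᵐ[μ] condLExp m μ (fun x => W x * g x) := by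
  have hu : Measurable[m] (condLExp m (μ.withDensity W) g) := measurable_condLExp m _ g
  refine ae_eq_condLExp hm μ _ (hu.mul (measurable_condLExp m μ W)) fun s hs => ?_
  have h := lintegral_mul_condLExp hm μ
    (y := s.indicator (condLExp m (μ.withDensity W) g)) (hu.indicator hs) hW
  simp_rw [← Set.indicator_mul_left] at h
  rw [lintegral_indicator (hm s hs), lintegral_indicator (hm s hs)] at h
  rw [h]
  have h2 := setLIntegral_condLExp hm (μ.withDensity W) g hs
  rw [setLIntegral_withDensity_eq_setLIntegral_mul μ hW (hu.mono hm le_rfl) (hm s hs),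
    setLIntegral_withDensity_eq_setLIntegral_mul μ hW hg (hm s hs)] at h2
  simpa only [Pi.mul_apply, mul_comm (W _)] using h2

/-- If `W` is integrable over the `m`-measurable sets of finite measure, then `W μ` is
`σ`-finite on `m`. -/
theorem sigmaFinite_trim_withDensity (hm : m ≤ m0) (μ : Measure Ω) [SigmaFinite (μ.trim hm)]
    {W : Ω → ℝ≥0∞}
    (hWfin : ∀ E, MeasurableSet[m] E → μ E < ∞ → ∫⁻ x in E, W x ∂μ < ∞) :
    SigmaFinite ((μ.withDensity W).trim hm) := by
  refine ⟨⟨⟨spanningSets (μ.trim hm), fun _ => trivial, fun n => ?_, iUnion_spanningSets _⟩⟩⟩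
  have hs := measurableSet_spanningSets (μ.trim hm) n
  rw [trim_measurableSet_eq hm hs, withDensity_apply _ (hm _ hs)]
  refine hWfin _ hs ?_
  rw [← trim_measurableSet_eq hm hs]
  exact measure_spanningSets_lt_top _ n

/-- An inequality between set functions that holds on the `m`-measurable subsets of finite measure
of an `m`-measurable set holds on the set itself, by exhaustion. -/
theorem measure_le_of_forall_measure_lt_top (hm : m ≤ m0) (μ : Measure Ω) [SigmaFinite (μ.trim hm)]
    (ν₁ ν₂ : Measure Ω) {c : ℝ≥0∞} {θ : ℝ} (hθ : 0 ≤ θ)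
    {E : Set Ω} (hE : MeasurableSet[m] E)
    (h : ∀ F ⊆ E, MeasurableSet[m] F → μ F < ∞ → ν₁ F ≤ c * ν₂ F ^ θ) : ν₁ E ≤ c * ν₂ E ^ θ := by
  have hs := measurableSet_spanningSets (μ.trim hm)
  have hU : E = ⋃ n, E ∩ spanningSets (μ.trim hm) n := by
    rw [← Set.inter_iUnion, iUnion_spanningSets, Set.inter_univ]
  have hmono : Monotone fun n => E ∩ spanningSets (μ.trim hm) n :=
    fun a b hab => Set.inter_subset_inter_right _ (monotone_spanningSets _ hab)
  conv_lhs => rw [hU]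
  rw [hmono.measure_iUnion]
  refine iSup_le fun n => (h _ Set.inter_subset_left (hE.inter (hs n)) ?_).trans ?_
  · refine (measure_mono Set.inter_subset_right).trans_lt ?_
    rw [← trim_measurableSet_eq hm (hs n)]
    exact measure_spanningSets_lt_top _ n
  · gcongr
    exact Set.inter_subset_left

end CondLExp

/-! ### Dyadic sums and duality in `ℝ≥0∞` -/

theorem rpow_eq_mul_rpow_sub_one {θ : ℝ} (hθ : 1 ≤ θ) (t : ℝ≥0∞) :
    t ^ θ = t * t ^ (θ - 1) := by
  have h := ENNReal.rpow_add_of_nonneg (x := t) 1 (θ - 1) zero_le_one (by linarith)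
  rwa [ENNReal.rpow_one, add_sub_cancel] at h

/-- The norm of `ℓ^θ` is at most the norm of `ℓ^1` for `θ ≥ 1`. -/
theorem tsum_rpow_le_rpow_tsum {ι : Type*} {θ : ℝ} (hθ : 1 ≤ θ) (a : ι → ℝ≥0∞) :
    ∑' k, a k ^ θ ≤ (∑' k, a k) ^ θ := by
  rw [rpow_eq_mul_rpow_sub_one hθ (∑' k, a k), ← ENNReal.tsum_mul_right]
  refine ENNReal.tsum_le_tsum fun k => ?_
  rw [rpow_eq_mul_rpow_sub_one hθ]
  gcongr
  exact ENNReal.le_tsum k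

/-- A power of `x` is dominated by the sum of the powers of the powers of two below `x`. -/
theorem rpow_le_tsum_zpow {r : ℝ} (hr : 0 < r) (x : ℝ≥0∞) :
    x ^ r ≤ 2 ^ r * ∑' k : ℤ, if (2 : ℝ≥0∞) ^ k < x then ((2 : ℝ≥0∞) ^ k) ^ r else 0 := by
  rcases eq_or_ne x 0 with rfl | h0
  · simp [hr]
  rcases eq_or_ne x ∞ with rfl | htop
  · have h2 : ∀ k : ℤ, (2 : ℝ≥0∞) ^ k < ∞ := fun k => ENNReal.zpow_lt_top two_ne_zero (by simp) k
    have : (∑' k : ℤ, if (2 : ℝ≥0∞) ^ k < ∞ then ((2 : ℝ≥0∞) ^ k) ^ r else 0) = ∞ := by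
      simp only [h2, if_true]
      refine top_le_iff.1 ?_
      have hinj : Function.Injective (fun n : ℕ => (n : ℤ)) := Nat.cast_injective
      refine le_trans ?_ (ENNReal.tsum_comp_le_tsum_of_injective hinj _)
      rw [← ENNReal.tsum_const_eq_top_of_ne_zero (α := ℕ) (c := 1) one_ne_zero]
      refine ENNReal.tsum_le_tsum fun n => ?_
      refine ENNReal.one_le_rpow ?_ hr
      simpa using one_le_pow₀ (one_le_two (α := ℝ≥0∞))
    rw [this]
    simp [ENNReal.mul_top, hr]
  · obtain ⟨k, hk1, hk2⟩ := ENNReal.exists_mem_Ioc_zpow h0 htop ENNReal.one_lt_two (by simp)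
    calc x ^ r ≤ ((2 : ℝ≥0∞) ^ (k + 1)) ^ r := by gcongr
      _ = 2 ^ r * ((2 : ℝ≥0∞) ^ k) ^ r := by
        rw [ENNReal.zpow_add two_ne_zero (by simp), zpow_one,
          ENNReal.mul_rpow_of_nonneg _ _ hr.le, mul_comm]
      _ ≤ _ := by
        gcongr
        refine le_trans ?_ (ENNReal.le_tsum k)
        rw [if_pos hk1]

/-- The sum of the geometric series with ratio `2^{-s}`. -/
noncomputable def geomConst (s : ℝ) : ℝ≥0∞ := ∑' n : ℕ, ((2 : ℝ≥0∞)⁻¹ ^ s) ^ n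

theorem geomConst_ne_top {s : ℝ} (hs : 0 < s) : geomConst s ≠ ∞ := by
  rw [geomConst, ENNReal.tsum_geometric]
  have : (2 : ℝ≥0∞)⁻¹ ^ s < 1 := ENNReal.rpow_lt_one (by simp) hs
  simpa [ENNReal.inv_eq_top, tsub_eq_zero_iff_le] using this

/-- The sum of the powers of the powers of two below `x` is dominated by a power of `x`. -/
theorem tsum_zpow_le_rpow {s : ℝ} (hs : 0 < s) (x : ℝ≥0∞) :
    ∑' k : ℤ, (if (2 : ℝ≥0∞) ^ k < x then ((2 : ℝ≥0∞) ^ k) ^ s else 0)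
      ≤ geomConst s * x ^ s := by
  rcases eq_or_ne x 0 with rfl | h0
  · simp
  rcases eq_or_ne x ∞ with rfl | htop
  · have : geomConst s ≠ 0 := by
      refine (lt_of_lt_of_le zero_lt_one ?_).ne'
      exact (pow_zero ((2 : ℝ≥0∞)⁻¹ ^ s)).symm.le.trans
        (ENNReal.le_tsum (f := fun n : ℕ => ((2 : ℝ≥0∞)⁻¹ ^ s) ^ n) 0)
    simp [hs, ENNReal.mul_top this]
  · obtain ⟨k, hk1, hk2⟩ := ENNReal.exists_mem_Ioc_zpow h0 htop ENNReal.one_lt_two (by simp)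
    have hinj : Function.Injective (fun n : ℕ => k - (n : ℤ)) := fun a b h => by
      simpa using h
    rw [← hinj.tsum_eq]
    · rw [mul_comm, geomConst, ← ENNReal.tsum_mul_left]
      refine ENNReal.tsum_le_tsum fun n => ?_
      split_ifs
      · rw [← ENNReal.rpow_natCast, ← ENNReal.rpow_mul, mul_comm s, ENNReal.rpow_mul,
          ENNReal.rpow_natCast, ← ENNReal.mul_rpow_of_nonneg _ _ hs.le]
        gcongr
        rw [sub_eq_add_neg, ENNReal.zpow_add two_ne_zero (by simp), ENNReal.zpow_neg, zpow_natCast,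
          ← ENNReal.inv_pow]
        gcongr
      · exact zero_le
    · intro j hj
      have hj' : (2 : ℝ≥0∞) ^ j < x := by
        by_contra hcon
        simp [hcon] at hj
      have hjk : j < k + 1 := by
        by_contra hcon
        exact absurd (hj'.trans_le hk2)
          (not_lt.2 (ENNReal.zpow_le_of_le one_le_two (not_lt.1 hcon)))
      exact ⟨(k - j).toNat, by
        have : ((k - j).toNat : ℤ) = k - j := Int.toNat_of_nonneg (by omega)
        simp [this]⟩

/-- Converse of Hölder's inequality: the `L^q` norm of `H` is bounded by the best constant in the
pairings of `H` with bounded functions of finite `L^{q'}` norm. -/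
theorem lintegral_rpow_le_of_forall_pairing {m0 : MeasurableSpace Ω} (ν : Measure Ω)
    [SigmaFinite ν] {q s : ℝ} (hqs : q.HolderConjugate s) {H : Ω → ℝ≥0∞} (hH : Measurable H)
    {C : ℝ≥0∞}
    (h : ∀ g : Ω → ℝ≥0∞, Measurable g → (∀ x, g x ≠ ∞) → ∫⁻ x, g x ^ s ∂ν ≠ ∞ →
      ∫⁻ x, H x * g x ∂ν ≤ C * (∫⁻ x, g x ^ s ∂ν) ^ (1 / s)) :
    (∫⁻ x, H x ^ q ∂ν) ^ (1 / q) ≤ C := by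
  have hq := hqs.pos
  have hs := hqs.symm.pos
  let S := spanningSets ν
  have hS := measurableSet_spanningSets ν
  let H' : ℕ → Ω → ℝ≥0∞ := fun n => (S n).indicator fun x => min (H x) n
  have hH'm : ∀ n, Measurable (H' n) := fun n => (hH.min measurable_const).indicator (hS n)
  have hmono : Monotone H' := by
    intro a b hab x
    refine (Set.indicator_le_indicator_of_subset (monotone_spanningSets ν hab)
      (fun _ => zero_le) x).trans (Set.indicator_le_indicator ?_)
    gcongr
  have hle : ∀ n x, H' n x ≤ H x := fun n x =>
    Set.indicator_apply_le' (fun _ => min_le_left _ _) fun _ => zero_le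
  have hle' : ∀ n x, H' n x ≤ n := fun n x =>
    Set.indicator_apply_le' (fun _ => min_le_right _ _) fun _ => zero_le
  have hsup : ∀ x, ⨆ n, H' n x = H x := by
    intro x
    refine le_antisymm (iSup_le fun n => hle n x) (le_of_forall_lt fun c hc => ?_)
    obtain ⟨k, hk⟩ := ENNReal.exists_nat_gt hc.ne_top
    have hx : x ∈ ⋃ n, S n := by simp [S, iUnion_spanningSets]
    obtain ⟨l, hl⟩ := Set.mem_iUnion.1 hx
    refine lt_of_lt_of_le ?_ (le_iSup (fun n => H' n x) (max k l))
    simp only [H']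
    rw [Set.indicator_of_mem (monotone_spanningSets ν (le_max_right k l) hl)]
    exact lt_min hc (hk.trans_le (by exact_mod_cast le_max_left k l))
  have hfin : ∀ n x, H' n x ≠ ∞ := fun n x =>
    ((hle' n x).trans_lt (ENNReal.natCast_lt_top n)).ne
  have hI : ∀ n, ∫⁻ x, H' n x ^ q ∂ν ≠ ∞ := by
    intro n
    refine ne_top_of_le_ne_top (b := (n : ℝ≥0∞) ^ q * ν (S n)) ?_ ?_
    · exact ENNReal.mul_ne_top (ENNReal.rpow_ne_top_of_nonneg hq.le (by simp))
        (measure_spanningSets_lt_top ν n).ne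
    · rw [← setLIntegral_const, ← lintegral_indicator (hS n)]
      refine lintegral_mono fun x => ?_
      by_cases hx : x ∈ S n
      · rw [Set.indicator_of_mem hx]
        have := hle' n x
        gcongr
      · simp [H', hx, hq]
  -- Test with the power `q - 1` of the truncation `H' n`, for which Hölder's inequality is sharp.
  have hpt : ∀ n x, H' n x ^ q ≤ H x * H' n x ^ (q - 1) := by
    intro n x
    rw [rpow_eq_mul_rpow_sub_one hqs.lt.le]
    gcongr
    exact hle n x
  have bound : ∀ n, (∫⁻ x, H' n x ^ q ∂ν) ^ (1 / q) ≤ C := by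
    intro n
    have hgs : ∀ x, (H' n x ^ (q - 1)) ^ s = H' n x ^ q := fun x => by
      rw [← ENNReal.rpow_mul, hqs.sub_one_mul_conj]
    have h1 := h (fun x => H' n x ^ (q - 1)) ((hH'm n).pow_const _)
      (fun x => ENNReal.rpow_ne_top_of_nonneg hqs.sub_one_pos.le (hfin n x))
      (by simpa only [hgs] using hI n)
    simp only [hgs] at h1
    have h2 := (lintegral_mono (hpt n)).trans h1
    rcases eq_or_ne (∫⁻ x, H' n x ^ q ∂ν) 0 with h0 | h0
    · rw [h0, ENNReal.zero_rpow_of_pos (by positivity)]; exact zero_le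
    have h3 : (∫⁻ x, H' n x ^ q ∂ν) = (∫⁻ x, H' n x ^ q ∂ν) ^ (1 / q)
        * (∫⁻ x, H' n x ^ q ∂ν) ^ (1 / s) := by
      rw [← ENNReal.rpow_add _ _ h0 (hI n), one_div, one_div, hqs.inv_add_inv_eq_one,
        ENNReal.rpow_one]
    have h4 : (∫⁻ x, H' n x ^ q ∂ν) ^ (1 / s) ≠ 0 := by
      simp [ENNReal.rpow_eq_zero_iff, h0, hI n]
    have h5 : (∫⁻ x, H' n x ^ q ∂ν) ^ (1 / s) ≠ ∞ :=
      ENNReal.rpow_ne_top_of_nonneg (by positivity) (hI n)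
    -- The finite nonzero factor `(∫ H' n ^ q) ^ (1 / s)` cancels.
    exact (ENNReal.mul_le_mul_iff_left h4 h5).1 (h3.symm.le.trans h2)
  have hlim : ∫⁻ x, H x ^ q ∂ν = ⨆ n, ∫⁻ x, H' n x ^ q ∂ν := by
    rw [← lintegral_iSup (fun n => (hH'm n).pow_const _)]
    · congr 1 with x
      rw [← hsup x]
      exact (ENNReal.orderIsoRpow q hq).map_iSup _
    · intro a b hab x
      have := hmono hab x
      dsimp only
      gcongr
  simp only [one_div, ENNReal.rpow_inv_le_iff hq] at bound ⊢
  rw [hlim]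
  exact iSup_le bound

/-! ### Level sets and Doob's maximal inequality -/

/-- The set where the sequence `u` exceeds the level `t` at time `n` for the first time. -/
def firstPassage (u : ℕ → Ω → ℝ≥0∞) (t : ℝ≥0∞) (n : ℕ) : Set Ω :=
  {x | t < u n x ∧ ∀ k < n, u k x ≤ t}

theorem disjoint_firstPassage (u : ℕ → Ω → ℝ≥0∞) (t : ℝ≥0∞) :
    Pairwise (Function.onFun Disjoint (firstPassage u t)) := by
  intro a b hab
  refine Set.disjoint_left.2 fun x hxa hxb => ?_
  rcases lt_or_gt_of_ne hab with h | h
  · exact absurd hxa.1 (not_lt.2 (hxb.2 a h))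
  · exact absurd hxb.1 (not_lt.2 (hxa.2 b h))

theorem exists_le_mem_firstPassage {u : ℕ → Ω → ℝ≥0∞} {t : ℝ≥0∞} {n : ℕ} {x : Ω}
    (h : t < u n x) : ∃ j ≤ n, x ∈ firstPassage u t j := by
  classical
  have hex : ∃ j, t < u j x := ⟨n, h⟩
  exact ⟨Nat.find hex, Nat.find_min' hex h, Nat.find_spec hex,
    fun k hk => not_lt.1 (Nat.find_min hex hk)⟩

theorem iUnion_firstPassage (u : ℕ → Ω → ℝ≥0∞) (t : ℝ≥0∞) :
    ⋃ n, firstPassage u t n = {x | t < ⨆ n, u n x} := by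
  ext x
  simp only [Set.mem_iUnion, Set.mem_ofPred_eq, lt_iSup_iff]
  constructor
  · rintro ⟨n, hn⟩
    exact ⟨n, hn.1⟩
  · rintro ⟨n, hn⟩
    obtain ⟨j, -, hj⟩ := exists_le_mem_firstPassage hn
    exact ⟨j, hj⟩

variable {m0 : MeasurableSpace Ω}

theorem measurableSet_firstPassage {𝒢 : Filtration ℕ m0} {u : ℕ → Ω → ℝ≥0∞}
    (hu : ∀ n, Measurable[𝒢 n] (u n)) (t : ℝ≥0∞) (n : ℕ) :
    MeasurableSet[𝒢 n] (firstPassage u t n) := by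
  have h1 : MeasurableSet[𝒢 n] {x | t < u n x} := hu n measurableSet_Ioi
  have h2 : MeasurableSet[𝒢 n] (⋂ k, ⋂ (_ : k < n), {x | u k x ≤ t}) := by
    refine MeasurableSet.iInter fun k => MeasurableSet.iInter fun hk => ?_
    exact (hu k).mono (𝒢.mono hk.le) le_rfl measurableSet_Iic
  convert! h1.inter h2 using 1
  ext x
  simp [firstPassage]

/-- Doob's weak-type inequality: on the level set `{sup_n E_n f > 2t}` only the part of `f`
above the level `t` matters. -/
theorem mul_measure_lt_iSup_condLExp_le (ν : Measure Ω) (𝒢 : Filtration ℕ m0)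
    [SigmaFiniteFiltration ν 𝒢] {f : Ω → ℝ≥0∞} (hf : Measurable f) {t : ℝ≥0∞} (ht : t ≠ ∞) :
    t * ν {x | 2 * t < ⨆ n, condLExp (𝒢 n) ν f x} ≤ ∫⁻ x in {x | t < f x}, f x ∂ν := by
  have hS : MeasurableSet {x | t < f x} := hf measurableSet_Ioi
  set F : Ω → ℝ≥0∞ := {x | t < f x}.indicator f with hF
  have hFm : Measurable F := hf.indicator hS
  have hle : ∀ x, f x ≤ F x + t := by
    intro x
    by_cases hx : t < f x
    · simp [hF, hx]
    · exact (not_lt.1 hx).trans le_add_self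
  set u : ℕ → Ω → ℝ≥0∞ := fun n => condLExp (𝒢 n) ν f with hu
  have hum : ∀ n, Measurable[𝒢 n] (u n) := fun n => measurable_condLExp _ _ _
  set A := firstPassage u (2 * t) with hA
  have hAm : ∀ n, MeasurableSet[𝒢 n] (A n) := measurableSet_firstPassage hum _
  have piece : ∀ n, (t • ν) (A n) ≤ 1 * (ν.withDensity F) (A n) ^ (1 : ℝ) := by
    intro n
    refine measure_le_of_forall_measure_lt_top (𝒢.le n) ν _ _ zero_le_one (hAm n)
      fun E hEA hE hEfin => ?_
    have hE' := 𝒢.le n _ hE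
    rw [ENNReal.rpow_one, one_mul, withDensity_apply _ hE', Measure.smul_apply, smul_eq_mul]
    have h1 : 2 * t * ν E ≤ ∫⁻ x in E, u n x ∂ν := by
      rw [← setLIntegral_const]
      exact setLIntegral_mono' hE' fun x hx => (hEA hx).1.le
    have h2 : ∫⁻ x in E, u n x ∂ν ≤ ∫⁻ x in E, F x ∂ν + t * ν E := by
      rw [hu, setLIntegral_condLExp (𝒢.le n) ν f hE, ← setLIntegral_const,
        ← lintegral_add_left hFm]
      exact lintegral_mono hle
    -- `E` has finite measure, so the term `t * ν E` coming from `{f ≤ t}` can be absorbed.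
    have h3 := h1.trans h2
    rw [two_mul, add_mul] at h3
    exact (ENNReal.add_le_add_iff_right (ENNReal.mul_ne_top ht hEfin.ne)).1 h3
  have hpiece : ∀ n, t * ν (A n) ≤ (ν.withDensity F) (A n) := by
    intro n
    simpa using piece n
  have hAm' : ∀ n, MeasurableSet (A n) := fun n => 𝒢.le n _ (hAm n)
  calc t * ν {x | 2 * t < ⨆ n, u n x} = ∑' n, t * ν (A n) := by
        rw [← iUnion_firstPassage, measure_iUnion (disjoint_firstPassage u _) hAm',
          ENNReal.tsum_mul_left]
    _ ≤ ∑' n, (ν.withDensity F) (A n) := ENNReal.tsum_le_tsum hpiece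
    _ = (ν.withDensity F) (⋃ n, A n) := (measure_iUnion (disjoint_firstPassage u _) hAm').symm
    _ ≤ (ν.withDensity F) Set.univ := measure_mono (Set.subset_univ _)
    _ = ∫⁻ x in {x | t < f x}, f x ∂ν := by
        rw [withDensity_apply _ .univ, setLIntegral_univ, hF, lintegral_indicator hS]

/-- A constant for Doob's maximal inequality in `L^p`. -/
noncomputable def doobConst (p : ℝ) : ℝ≥0∞ := 2 ^ p * (2 ^ p * geomConst (p - 1))

theorem doobConst_ne_top {p : ℝ} (hp : 1 < p) : doobConst p ≠ ∞ := by
  have h2 : (2 : ℝ≥0∞) ^ p ≠ ∞ := ENNReal.rpow_ne_top_of_nonneg (by linarith) (by simp)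
  exact ENNReal.mul_ne_top h2 (ENNReal.mul_ne_top h2 (geomConst_ne_top (by linarith)))

theorem lintegral_tsum_zpow_ite (ν : Measure Ω) {U : Ω → ℝ≥0∞} (hU : Measurable U)
    (s : ℝ) :
    ∫⁻ x, (∑' k : ℤ, if (2 : ℝ≥0∞) ^ k < U x then ((2 : ℝ≥0∞) ^ k) ^ s else 0) ∂ν
      = ∑' k : ℤ, ((2 : ℝ≥0∞) ^ k) ^ s * ν {x | (2 : ℝ≥0∞) ^ k < U x} := by
  have hm : ∀ k : ℤ, MeasurableSet {x | (2 : ℝ≥0∞) ^ k < U x} := fun k => hU measurableSet_Ioi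
  rw [lintegral_tsum fun k => (Measurable.ite (hm k) measurable_const measurable_const).aemeasurable]
  refine tsum_congr fun k => ?_
  rw [← setLIntegral_const, ← lintegral_indicator (hm k)]
  refine lintegral_congr fun x => ?_
  by_cases hx : (2 : ℝ≥0∞) ^ k < U x <;> simp [hx]

/-- **Doob's maximal inequality** in `L^p` for a nonnegative function on a `σ`-finite filtered
measure space. -/
theorem lintegral_iSup_condLExp_rpow_le {p : ℝ} (hp : 1 < p) (ν : Measure Ω)
    (𝒢 : Filtration ℕ m0) [SigmaFiniteFiltration ν 𝒢] {f : Ω → ℝ≥0∞} (hf : Measurable f) :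
    ∫⁻ x, (⨆ n, condLExp (𝒢 n) ν f x) ^ p ∂ν ≤ doobConst p * ∫⁻ x, f x ^ p ∂ν := by
  have hp0 : 0 < p := by linarith
  set U : Ω → ℝ≥0∞ := fun x => ⨆ n, condLExp (𝒢 n) ν f x with hU
  have hUm : Measurable U := Measurable.iSup fun n => measurable_condLExp' _ _ _
  have h2 : ∀ k : ℤ, (2 : ℝ≥0∞) ^ k ≠ ∞ := fun k =>
    (ENNReal.zpow_lt_top two_ne_zero (by simp) k).ne
  have hS : ∀ k : ℤ, MeasurableSet {x | (2 : ℝ≥0∞) ^ k < f x} := fun k => hf measurableSet_Ioi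
  calc ∫⁻ x, U x ^ p ∂ν
      ≤ ∫⁻ x, 2 ^ p * (∑' k : ℤ, if (2 : ℝ≥0∞) ^ k < U x then ((2 : ℝ≥0∞) ^ k) ^ p else 0) ∂ν :=
        lintegral_mono fun x => rpow_le_tsum_zpow hp0 (U x)
    _ = 2 ^ p * ∑' k : ℤ, ((2 : ℝ≥0∞) ^ k) ^ p * ν {x | (2 : ℝ≥0∞) ^ k < U x} := by
        rw [lintegral_const_mul' _ _ (ENNReal.rpow_ne_top_of_nonneg hp0.le (by simp)),
          lintegral_tsum_zpow_ite ν hUm]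
    _ = 2 ^ p * ∑' k : ℤ, 2 ^ p * (((2 : ℝ≥0∞) ^ k) ^ (p - 1) *
          ((2 : ℝ≥0∞) ^ k * ν {x | 2 * (2 : ℝ≥0∞) ^ k < U x})) := by
        -- Shift the index by one, so that the weak-type inequality applies at the level `2 ^ k`.
        rw [← (Equiv.addRight (1 : ℤ)).tsum_eq]
        congr 1
        refine tsum_congr fun k => ?_
        have h3 : (2 : ℝ≥0∞) ^ (k + 1) = 2 * (2 : ℝ≥0∞) ^ k := by
          rw [ENNReal.zpow_add two_ne_zero (by simp), zpow_one, mul_comm]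
        rw [Equiv.coe_addRight, h3, ENNReal.mul_rpow_of_nonneg _ _ hp0.le,
          rpow_eq_mul_rpow_sub_one hp.le ((2 : ℝ≥0∞) ^ k)]
        ring
    _ ≤ 2 ^ p * ∑' k : ℤ, 2 ^ p * (((2 : ℝ≥0∞) ^ k) ^ (p - 1) *
          ∫⁻ x in {x | (2 : ℝ≥0∞) ^ k < f x}, f x ∂ν) := by
        gcongr with k
        exact mul_measure_lt_iSup_condLExp_le ν 𝒢 hf (h2 k)
    _ = 2 ^ p * (2 ^ p * ∫⁻ x, f x *
          (∑' k : ℤ, if (2 : ℝ≥0∞) ^ k < f x then ((2 : ℝ≥0∞) ^ k) ^ (p - 1) else 0) ∂ν) := by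
        rw [ENNReal.tsum_mul_left]
        simp_rw [← ENNReal.tsum_mul_left (a := f _)]
        rw [lintegral_tsum]
        · congr 2
          refine tsum_congr fun k : ℤ => ?_
          rw [← lintegral_indicator (hS k), ← lintegral_const_mul _ (hf.indicator (hS k))]
          refine lintegral_congr fun x => ?_
          by_cases hx : (2 : ℝ≥0∞) ^ k < f x
          · simp [hx, mul_comm]
          · simp [hx]
        · exact fun k =>
            (hf.mul (Measurable.ite (hS k) measurable_const measurable_const)).aemeasurable
    _ ≤ 2 ^ p * (2 ^ p * ∫⁻ x, geomConst (p - 1) * f x ^ p ∂ν) := by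
        refine mul_le_mul_right (mul_le_mul_right (lintegral_mono fun x => ?_) _) _
        rw [rpow_eq_mul_rpow_sub_one hp.le (f x), mul_left_comm]
        refine mul_le_mul_right ?_ _
        exact tsum_zpow_le_rpow (by linarith) (f x)
    _ = doobConst p * ∫⁻ x, f x ^ p ∂ν := by
        rw [lintegral_const_mul' _ _ (geomConst_ne_top (by linarith)), doobConst]
        ring

/-! ### Domination of the positive operator by a maximal function -/

theorem tsum_ite_le_eq_tsum_add (j : ℕ) (a : ℕ → ℝ≥0∞) :
    ∑' n, (if j ≤ n then a n else 0) = ∑' k, a (j + k) := by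
  have hinj : Function.Injective (fun k : ℕ => j + k) := fun a b h => by simpa using h
  rw [← hinj.tsum_eq]
  · simp
  · intro n hn
    have : j ≤ n := by
      by_contra hcon
      simp [hcon] at hn
    exact ⟨n - j, by simp [this]⟩

/-- The increments of a sequence in `ℝ≥0∞`, starting from `0`. -/
noncomputable def increment (F : ℕ → ℝ≥0∞) : ℕ → ℝ≥0∞
  | 0 => F 0
  | n + 1 => F (n + 1) - F n

theorem sum_increment {F : ℕ → ℝ≥0∞} (hF : Monotone F) (n : ℕ) :
    ∑ j ∈ Finset.range (n + 1), increment F j = F n := by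
  induction n with
  | zero => simp [increment]
  | succ n ih =>
    rw [Finset.sum_range_succ, ih]
    exact add_tsub_cancel_of_le (hF n.le_succ)

theorem tsum_increment_le {F : ℕ → ℝ≥0∞} (hF : Monotone F) :
    ∑' j, increment F j ≤ ⨆ n, F n := by
  rw [ENNReal.tsum_eq_iSup_nat]
  refine iSup_le fun n => ?_
  refine (Finset.sum_le_sum_of_subset (Finset.range_mono n.le_succ)).trans ?_
  rw [sum_increment hF]
  exact le_iSup F n

/-- Summation by parts: a weighted sum of a monotone sequence in terms of its increments and of
the tail sums of the weights. -/
theorem tsum_mul_eq_tsum_increment_mul {F : ℕ → ℝ≥0∞} (hF : Monotone F) (a : ℕ → ℝ≥0∞) :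
    ∑' n, a n * F n = ∑' j, increment F j * ∑' k, a (j + k) := by
  calc ∑' n, a n * F n = ∑' n, ∑' j, (if j ≤ n then a n * increment F j else 0) := by
        refine tsum_congr fun n => ?_
        rw [← sum_increment hF n, Finset.mul_sum,
          tsum_eq_sum (s := Finset.range (n + 1)) (fun j hj => if_neg (by simpa using hj))]
        refine Finset.sum_congr rfl fun j hj => ?_
        rw [if_pos (by simpa [Nat.lt_succ_iff] using hj)]
    _ = ∑' j, ∑' n, (if j ≤ n then a n * increment F j else 0) := ENNReal.tsum_comm
    _ = _ := by
        refine tsum_congr fun j => ?_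
        rw [tsum_ite_le_eq_tsum_add j fun n => a n * increment F j, ENNReal.tsum_mul_right,
          mul_comm]

/-- The bilinear form of the positive operator with coefficients `α` is dominated by the product
of the maximal function of `f` and of the maximal function of `h` with weights `β`, as soon as the
tails of `α` are dominated by the adapted sequence `β`. -/
theorem lintegral_tsum_mul_condLExp_le (μ : Measure Ω) (𝒢 : Filtration ℕ m0)
    [SigmaFiniteFiltration μ 𝒢] {α β : ℕ → Ω → ℝ≥0∞} (hα : ∀ n, Measurable[𝒢 n] (α n))
    (hβ : ∀ n, Measurable[𝒢 n] (β n)) {κ : ℝ≥0∞} (hκ : κ ≠ ∞)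
    (hαβ : ∀ n, ∀ᵐ x ∂μ, ∑' k, α (n + k) x ≤ κ * β n x) {f h : Ω → ℝ≥0∞}
    (hh : Measurable h) :
    ∫⁻ x, (∑' n, α n x * condLExp (𝒢 n) μ f x) * h x ∂μ
      ≤ κ * ∫⁻ x, (⨆ n, β n x * condLExp (𝒢 n) μ h x)
          * (⨆ n, condLExp (𝒢 n) μ f x) ∂μ := by
  set u : ℕ → Ω → ℝ≥0∞ := fun n => condLExp (𝒢 n) μ f with hu
  set v : ℕ → Ω → ℝ≥0∞ := fun n => condLExp (𝒢 n) μ h with hv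
  have hum : ∀ n, Measurable[𝒢 n] (u n) := fun n => measurable_condLExp _ _ _
  have hvm : ∀ n, Measurable[𝒢 n] (v n) := fun n => measurable_condLExp _ _ _
  set F : ℕ → Ω → ℝ≥0∞ := fun n x => ⨆ k : Set.Iic n, u k x with hF
  have hFm : ∀ n, Measurable[𝒢 n] (F n) := fun n =>
    Measurable.iSup fun k : Set.Iic n => (hum k).mono (𝒢.mono k.2) le_rfl
  have hFmono : ∀ x, Monotone fun n => F n x := fun x a b hab =>
    iSup_le fun k => le_iSup (fun k : Set.Iic b => u k x) ⟨k, k.2.trans hab⟩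
  have huF : ∀ n x, u n x ≤ F n x := fun n x =>
    le_iSup (fun k : Set.Iic n => u k x) ⟨n, Set.mem_Iic.2 le_rfl⟩
  have hFu : ∀ x, ⨆ n, F n x ≤ ⨆ n, u n x := fun x =>
    iSup_le fun n => iSup_le fun k => le_iSup (fun n => u n x) (k : ℕ)
  set d : ℕ → Ω → ℝ≥0∞ := fun j x => increment (fun n => F n x) j with hd
  have hdm : ∀ j, Measurable[𝒢 j] (d j) := by
    intro j
    cases j with
    | zero => exact hFm 0
    | succ j => exact (hFm (j + 1)).sub ((hFm j).mono (𝒢.mono j.le_succ) le_rfl)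
  have up : ∀ {n} {y : Ω → ℝ≥0∞}, Measurable[𝒢 n] y → Measurable y :=
    fun {n} _ hy => hy.mono (𝒢.le n) le_rfl
  calc ∫⁻ x, (∑' n, α n x * u n x) * h x ∂μ
      = ∑' n, ∫⁻ x, (α n x * u n x) * h x ∂μ := by
        simp_rw [← ENNReal.tsum_mul_right]
        exact lintegral_tsum fun n => (((up (hα n)).mul (up (hum n))).mul hh).aemeasurable
    _ = ∑' n, ∫⁻ x, (α n x * u n x) * v n x ∂μ := tsum_congr fun n =>
        (lintegral_mul_condLExp (𝒢.le n) μ ((hα n).mul (hum n)) hh).symm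
    _ ≤ ∑' n, ∫⁻ x, (α n x * F n x) * v n x ∂μ := by
        refine ENNReal.tsum_le_tsum fun n => lintegral_mono fun x => ?_
        have := huF n x
        dsimp only
        gcongr
    _ = ∑' n, ∫⁻ x, (α n x * F n x) * h x ∂μ := tsum_congr fun n =>
        lintegral_mul_condLExp (𝒢.le n) μ ((hα n).mul (hFm n)) hh
    _ = ∫⁻ x, (∑' n, α n x * F n x) * h x ∂μ := by
        simp_rw [← ENNReal.tsum_mul_right]
        exact (lintegral_tsum fun n =>
          (((up (hα n)).mul (up (hFm n))).mul hh).aemeasurable).symm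
    -- The conditional expectation has been removed from `h`, so the sum over `n` can be
    -- reorganized into tails of `α`; it is restored once the tails are replaced by `β`.
    _ = ∑' j, ∫⁻ x, d j x * (∑' k, α (j + k) x) * h x ∂μ := by
        rw [← lintegral_tsum (f := fun j x => d j x * (∑' k, α (j + k) x) * h x) fun j =>
          (((up (hdm j)).mul (Measurable.tsum fun k => up (hα (j + k)))).mul hh).aemeasurable]
        refine lintegral_congr fun x => ?_
        rw [tsum_mul_eq_tsum_increment_mul (hFmono x), ENNReal.tsum_mul_right]
    _ ≤ ∑' j, ∫⁻ x, κ * (d j x * β j x * h x) ∂μ := by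
        refine ENNReal.tsum_le_tsum fun j => lintegral_mono_ae ?_
        filter_upwards [hαβ j] with x hx
        calc d j x * (∑' k, α (j + k) x) * h x ≤ d j x * (κ * β j x) * h x := by gcongr
          _ = _ := by ring
    _ = κ * ∑' j, ∫⁻ x, d j x * β j x * v j x ∂μ := by
        rw [← ENNReal.tsum_mul_left]
        refine tsum_congr fun j => ?_
        rw [lintegral_const_mul' _ _ hκ]
        exact congrArg _ (lintegral_mul_condLExp (𝒢.le j) μ ((hdm j).mul (hβ j)) hh).symm
    _ = κ * ∫⁻ x, ∑' j, d j x * β j x * v j x ∂μ := by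
        rw [lintegral_tsum (f := fun j x => d j x * β j x * v j x) fun j =>
          (((up (hdm j)).mul (up (hβ j))).mul (up (hvm j))).aemeasurable]
    _ ≤ _ := by
        refine mul_le_mul_right (lintegral_mono fun x => ?_) _
        calc ∑' j, d j x * β j x * v j x
            ≤ ∑' j, (⨆ n, β n x * v n x) * d j x := by
              refine ENNReal.tsum_le_tsum fun j => ?_
              rw [mul_assoc, mul_comm]
              gcongr
              exact le_iSup (fun n => β n x * v n x) j
          _ ≤ _ := by
              rw [ENNReal.tsum_mul_left]
              exact mul_le_mul_right ((tsum_increment_le (hFmono x)).trans (hFu x)) _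

/-! ### Sawyer's testing theorem for the maximal operator -/

theorem iSup_rpow_le {ι : Sort*} {r : ℝ} (hr : 0 < r) {a : ι → ℝ≥0∞} {X : ℝ≥0∞}
    (h : ∀ i, a i ^ r ≤ X) : (⨆ i, a i) ^ r ≤ X := by
  rw [← ENNReal.le_rpow_inv_iff hr]
  exact iSup_le fun i => (ENNReal.le_rpow_inv_iff hr).2 (h i)

/-- The stopping-time argument for maximal functions: if the maximal functions of the tails of `b`
satisfy a testing condition with respect to the measure `ν`, then multiplication by `b` followed
by the supremum is bounded on adapted sequences, from `L^s(ν)` to `L^r(μ)`. The level sets of `u` are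
decomposed according to the first passage time, and `ℓ^1 ⊆ ℓ^{r/s}` is used to sum up. -/
theorem lintegral_iSup_mul_rpow_le {r s : ℝ} (hs : 0 < s) (hsr : s ≤ r) (μ ν : Measure Ω)
    (𝒢 : Filtration ℕ m0) [SigmaFiniteFiltration μ 𝒢] {b u : ℕ → Ω → ℝ≥0∞}
    (hb : ∀ n, Measurable (b n)) (hu : ∀ n, Measurable[𝒢 n] (u n)) {D : ℝ≥0∞}
    (htest : ∀ n E, MeasurableSet[𝒢 n] E → μ E < ∞ →
      ∫⁻ x in E, (⨆ k, b (n + k) x) ^ r ∂μ ≤ D * ν E ^ (r / s)) :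
    ∫⁻ x, (⨆ n, b n x * u n x) ^ r ∂μ
      ≤ 2 ^ r * (D * (geomConst s * ∫⁻ x, (⨆ n, u n x) ^ s ∂ν) ^ (r / s)) := by
  have hr : 0 < r := hs.trans_le hsr
  have hθ : 1 ≤ r / s := by rwa [one_le_div hs]
  set B : ℕ → Ω → ℝ≥0∞ := fun j x => ⨆ k, b (j + k) x with hB
  have hBm : ∀ j, Measurable (B j) := fun j => Measurable.iSup fun k => hb (j + k)
  set A : ℤ → ℕ → Set Ω := fun k j => firstPassage u ((2 : ℝ≥0∞) ^ k) j with hA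
  have hAm : ∀ k j, MeasurableSet[𝒢 j] (A k j) := fun k j => measurableSet_firstPassage hu _ j
  have hAm' : ∀ k j, MeasurableSet (A k j) := fun k j => 𝒢.le j _ (hAm k j)
  have hum : ∀ n, Measurable (u n) := fun n => (hu n).mono (𝒢.le n) le_rfl
  have hUm : Measurable fun x => ⨆ n, u n x := Measurable.iSup hum
  have h2 : ∀ k : ℤ, ((2 : ℝ≥0∞) ^ k) ^ r ≠ ∞ := fun k =>
    ENNReal.rpow_ne_top_of_nonneg hr.le (ENNReal.zpow_lt_top two_ne_zero (by simp) k).ne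
  have hpt : ∀ x, (⨆ n, b n x * u n x) ^ r
      ≤ 2 ^ r * ∑' k : ℤ, ((2 : ℝ≥0∞) ^ k) ^ r
          * ∑' j, (A k j).indicator (fun x => B j x ^ r) x := by
    intro x
    refine iSup_rpow_le hr fun n => ?_
    rw [ENNReal.mul_rpow_of_nonneg _ _ hr.le]
    refine (mul_le_mul_right (rpow_le_tsum_zpow hr (u n x)) _).trans ?_
    rw [mul_left_comm]
    refine mul_le_mul_right ?_ _
    rw [← ENNReal.tsum_mul_left]
    refine ENNReal.tsum_le_tsum fun k => ?_
    split_ifs with hk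
    · rw [mul_comm]
      refine mul_le_mul_right ?_ _
      obtain ⟨j, hjn, hj⟩ := exists_le_mem_firstPassage hk
      refine le_trans ?_ (ENNReal.le_tsum j)
      rw [Set.indicator_of_mem hj]
      refine ENNReal.rpow_le_rpow ?_ hr.le
      have := le_iSup (fun k => b (j + k) x) (n - j)
      rwa [Nat.add_sub_cancel' hjn] at this
    · simp
  have hpiece : ∀ k j, ∫⁻ x in A k j, B j x ^ r ∂μ ≤ D * ν (A k j) ^ (r / s) := by
    intro k j
    rw [← withDensity_apply _ (hAm' k j)]
    refine measure_le_of_forall_measure_lt_top (𝒢.le j) μ _ _ (by positivity) (hAm k j)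
      fun E _ hE hEfin => ?_
    rw [withDensity_apply _ (𝒢.le j _ hE)]
    exact htest j E hE hEfin
  calc ∫⁻ x, (⨆ n, b n x * u n x) ^ r ∂μ
      ≤ ∫⁻ x, 2 ^ r * ∑' k : ℤ, ((2 : ℝ≥0∞) ^ k) ^ r
          * ∑' j, (A k j).indicator (fun x => B j x ^ r) x ∂μ := lintegral_mono hpt
    _ = 2 ^ r * ∑' k : ℤ, ((2 : ℝ≥0∞) ^ k) ^ r * ∑' j, ∫⁻ x in A k j, B j x ^ r ∂μ := by
        have hm : ∀ k j, Measurable ((A k j).indicator fun x => B j x ^ r) := fun k j =>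
          ((hBm j).pow_const r).indicator (hAm' k j)
        rw [lintegral_const_mul' _ _ (ENNReal.rpow_ne_top_of_nonneg hr.le (by simp)),
          lintegral_tsum fun k => ((Measurable.tsum (hm k)).const_mul _).aemeasurable]
        congr 1
        refine tsum_congr fun k => ?_
        rw [lintegral_const_mul' _ _ (h2 k), lintegral_tsum fun j => (hm k j).aemeasurable]
        congr 1
        exact tsum_congr fun j => lintegral_indicator (hAm' k j) _
    _ ≤ 2 ^ r * ∑' k : ℤ, ((2 : ℝ≥0∞) ^ k) ^ r * ∑' j, D * ν (A k j) ^ (r / s) := by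
        gcongr with k j
        exact hpiece k j
    _ ≤ 2 ^ r * ∑' k : ℤ, ((2 : ℝ≥0∞) ^ k) ^ r
          * (D * ν {x | (2 : ℝ≥0∞) ^ k < ⨆ n, u n x} ^ (r / s)) := by
        gcongr with k
        rw [ENNReal.tsum_mul_left, ← iUnion_firstPassage,
          measure_iUnion (disjoint_firstPassage u _) (hAm' k)]
        gcongr
        exact tsum_rpow_le_rpow_tsum hθ _
    _ = 2 ^ r * (D * ∑' k : ℤ, (((2 : ℝ≥0∞) ^ k) ^ s
          * ν {x | (2 : ℝ≥0∞) ^ k < ⨆ n, u n x}) ^ (r / s)) := by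
        rw [← ENNReal.tsum_mul_left (a := D)]
        congr 1
        refine tsum_congr fun k => ?_
        rw [ENNReal.mul_rpow_of_nonneg _ _ (by positivity), ← ENNReal.rpow_mul,
          mul_div_cancel₀ _ hs.ne']
        ring
    _ ≤ 2 ^ r * (D * (∑' k : ℤ, ((2 : ℝ≥0∞) ^ k) ^ s
          * ν {x | (2 : ℝ≥0∞) ^ k < ⨆ n, u n x}) ^ (r / s)) := by
        gcongr
        exact tsum_rpow_le_rpow_tsum hθ _
    _ ≤ _ := by
        rw [← lintegral_tsum_zpow_ite ν hUm,
          ← lintegral_const_mul' _ _ (geomConst_ne_top hs)]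
        gcongr with x
        exact tsum_zpow_le_rpow hs _

/-- The sub-filtration of a filtration along a monotone sequence of indices. -/
def subFiltration {ι : Type*} [Preorder ι] (𝒢 : Filtration ι m0) (e : ℕ →o ι) :
    Filtration ℕ m0 where
  seq n := 𝒢 (e n)
  mono' _ _ h := 𝒢.mono (e.monotone h)
  le' n := 𝒢.le (e n)

instance {ι : Type*} [Preorder ι] (μ : Measure Ω) (𝒢 : Filtration ι m0)
    [SigmaFiniteFiltration μ 𝒢] (e : ℕ →o ι) :
    SigmaFiniteFiltration μ (subFiltration 𝒢 e) :=
  ⟨fun n => sigmaFinite_of_sigmaFiniteFiltration μ 𝒢 (e n)⟩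

/-- The maximal function attached to the positive operator is dominated, locally, by the positive
operator: `β_j E_j W` is at most a multiple of the conditional expectation given `𝒢_j` of the tail
of the positive operator applied to `W`, so that Doob's inequality applies. -/
theorem setLIntegral_iSup_mul_condLExp_rpow_le {r : ℝ} (hr : 1 < r) (μ : Measure Ω)
    (𝒢 : Filtration ℕ m0) [SigmaFiniteFiltration μ 𝒢] {α β : ℕ → Ω → ℝ≥0∞}
    (hα : ∀ n, Measurable[𝒢 n] (α n)) (hβ : ∀ n, Measurable[𝒢 n] (β n)) {κ : ℝ≥0∞}
    (hκ : κ ≠ ∞) (hβα : ∀ n, ∀ᵐ x ∂μ, β n x ≤ κ * ∑' k, α (n + k) x) {W : Ω → ℝ≥0∞}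
    (hW : Measurable W) (n : ℕ) {E : Set Ω} (hE : MeasurableSet[𝒢 n] E) :
    ∫⁻ x in E, (⨆ k, β (n + k) x * condLExp (𝒢 (n + k)) μ W x) ^ r ∂μ
      ≤ κ ^ r * (doobConst r *
        ∫⁻ x in E, (∑' k, α (n + k) x * condLExp (𝒢 (n + k)) μ W x) ^ r ∂μ) := by
  have hr0 : 0 < r := by linarith
  have up : ∀ {n} {y : Ω → ℝ≥0∞}, Measurable[𝒢 n] y → Measurable y :=
    fun {n} _ hy => hy.mono (𝒢.le n) le_rfl
  have hE' := 𝒢.le n _ hE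
  set v : ℕ → Ω → ℝ≥0∞ := fun j => condLExp (𝒢 j) μ W with hv
  have hvm : ∀ j, Measurable[𝒢 j] (v j) := fun j => measurable_condLExp _ _ _
  set G : Ω → ℝ≥0∞ := fun x => ∑' k, α (n + k) x * v (n + k) x with hG
  have hGm : Measurable G := Measurable.tsum fun k => (up (hα _)).mul (up (hvm _))
  have hGE : Measurable (E.indicator G) := hGm.indicator hE'
  -- With `j = n + k`, the left side is `E_j (1_E β_j W)`, which is at most
  -- `κ E_j (1_E ∑_l α_{j + l} W) = κ E_j (1_E ∑_l α_{j + l} E_{j + l} W)`.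
  have key : ∀ k, ∀ᵐ x ∂μ, E.indicator (fun x => β (n + k) x * v (n + k) x) x
      ≤ κ * condLExp (𝒢 (n + k)) μ (E.indicator G) x := by
    intro k
    set j := n + k with hj
    have hEj : MeasurableSet[𝒢 j] E := 𝒢.mono (Nat.le_add_right n k) _ hE
    set Y : ℕ → Ω → ℝ≥0∞ := fun l x => E.indicator (α (j + l)) x * W x with hY
    set Z : ℕ → Ω → ℝ≥0∞ := fun l x => E.indicator (α (j + l)) x * v (j + l) x with hZ
    have hαE : ∀ l, Measurable[𝒢 (j + l)] (E.indicator (α (j + l))) := fun l =>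
      (hα _).indicator (𝒢.mono (Nat.le_add_right j l) _ hEj)
    have h1 := condLExp_mul_left (𝒢.le j) μ ((hβ j).indicator hEj) hW
    have h2 : (fun x => E.indicator (β j) x * W x) ≤ᵐ[μ] κ • fun x => ∑' l, Y l x := by
      filter_upwards [hβα j] with x hx
      by_cases hxE : x ∈ E
      · simp only [Y, Set.indicator_of_mem hxE, Pi.smul_apply, smul_eq_mul]
        rw [ENNReal.tsum_mul_right, ← mul_assoc]
        gcongr
      · simp [hxE]
    -- `W` may be replaced by `E_{j + l} W` in the terms with coefficient `α_{j + l}`.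
    have h3 : condLExp (𝒢 j) μ (fun x => ∑' l, Y l x)
        =ᵐ[μ] condLExp (𝒢 j) μ (fun x => ∑' l, Z l x) := by
      refine ae_eq_condLExp (𝒢.le j) μ _ (measurable_condLExp _ _ _) fun S hS => ?_
      rw [setLIntegral_condLExp (𝒢.le j) μ _ hS,
        lintegral_tsum (f := Y) fun l => ((up (hαE l)).mul hW).aemeasurable,
        lintegral_tsum (f := Z) fun l => ((up (hαE l)).mul (up (hvm _))).aemeasurable]
      refine tsum_congr fun l => ?_
      have hS' : MeasurableSet[𝒢 (j + l)] S := 𝒢.mono (Nat.le_add_right j l) _ hS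
      have h := lintegral_mul_condLExp (𝒢.le (j + l)) μ ((hαE l).indicator hS') hW
      simp_rw [← Set.indicator_mul_left (s := S)] at h
      rw [lintegral_indicator (𝒢.le _ _ hS), lintegral_indicator (𝒢.le _ _ hS)] at h
      exact h.symm
    have h4 : (fun x => ∑' l, Z l x) ≤ᵐ[μ] E.indicator G := by
      refine Filter.Eventually.of_forall fun x => ?_
      by_cases hxE : x ∈ E
      · simp only [Z, hG, Set.indicator_of_mem hxE]
        have hinj : Function.Injective fun l : ℕ => k + l := fun a b h => by simpa using h
        have := ENNReal.tsum_comp_le_tsum_of_injective hinj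
          (fun l => α (n + l) x * v (n + l) x)
        simpa only [hj, add_assoc] using this
      · simp [Z, hxE]
    filter_upwards [h1, condLExp_mono (mΩ := 𝒢 j) h2,
      condLExp_smul' (P := μ) (mΩ := 𝒢 j) (fun x => ∑' l, Y l x) hκ, h3,
      condLExp_mono (mΩ := 𝒢 j) h4] with x e1 e2 e3 e4 e5
    rw [Set.indicator_mul_left]
    refine (e1.le.trans (e2.trans e3.le)).trans ?_
    rw [Pi.smul_apply, smul_eq_mul, e4]
    gcongr
  let e : ℕ →o ℕ := ⟨fun k => n + k, fun a b h => Nat.add_le_add_left h n⟩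
  have hdoob := lintegral_iSup_condLExp_rpow_le hr μ (subFiltration 𝒢 e) hGE
  calc ∫⁻ x in E, (⨆ k, β (n + k) x * v (n + k) x) ^ r ∂μ
      = ∫⁻ x, E.indicator (fun x => (⨆ k, β (n + k) x * v (n + k) x) ^ r) x ∂μ :=
        (lintegral_indicator hE' _).symm
    _ ≤ ∫⁻ x, κ ^ r * (⨆ k, condLExp (𝒢 (n + k)) μ (E.indicator G) x) ^ r ∂μ := by
        refine lintegral_mono_ae ?_
        filter_upwards [ae_all_iff.2 key] with x hx
        by_cases hxE : x ∈ E
        · simp only [Set.indicator_of_mem hxE] at hx ⊢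
          rw [← ENNReal.mul_rpow_of_nonneg _ _ hr0.le]
          refine ENNReal.rpow_le_rpow (iSup_le fun k => (hx k).trans ?_) hr0.le
          gcongr
          exact le_iSup (fun k => condLExp (𝒢 (n + k)) μ (E.indicator G) x) k
        · simp [hxE]
    _ ≤ κ ^ r * (doobConst r * ∫⁻ x, E.indicator G x ^ r ∂μ) := by
        rw [lintegral_const_mul' _ _ (ENNReal.rpow_ne_top_of_nonneg hr0.le hκ)]
        gcongr
        exact hdoob
    _ = _ := by
        rw [← lintegral_indicator hE']
        congr 2
        refine lintegral_congr fun x => ?_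
        by_cases hxE : x ∈ E <;> simp [hxE, hr0, hG, hv]

/-! ### The bilinear form of the positive operator -/

/-- The factor by which the constant of the testing condition is multiplied in the trace
inequality; here `r` and `s` are the conjugate exponents of `p` and `q`. -/
noncomputable def traceConst (p r s : ℝ) (κ : ℝ≥0∞) : ℝ≥0∞ :=
  κ * (2 * κ * doobConst r ^ (1 / r) * (geomConst s * doobConst s) ^ (1 / s)
    * doobConst p ^ (1 / p))

theorem traceConst_ne_top {p r s : ℝ} (hp : 1 < p) (hr : 1 < r) (hs : 1 < s) {κ : ℝ≥0∞}
    (hκ : κ ≠ ∞) : traceConst p r s κ ≠ ∞ := by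
  have h1 : ∀ {t : ℝ} {c : ℝ≥0∞}, 1 < t → c ≠ ∞ → c ^ (1 / t) ≠ ∞ := fun ht hc =>
    ENNReal.rpow_ne_top_of_nonneg (by positivity) hc
  have h2 := geomConst_ne_top (s := s) (by linarith)
  exact ENNReal.mul_ne_top hκ (ENNReal.mul_ne_top (ENNReal.mul_ne_top (ENNReal.mul_ne_top
    (ENNReal.mul_ne_top (by simp) hκ) (h1 hr (doobConst_ne_top hr)))
    (h1 hs (ENNReal.mul_ne_top h2 (doobConst_ne_top hs)))) (h1 hp (doobConst_ne_top hp)))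

/-- The bilinear trace inequality for a positive operator indexed by `ℕ`, under the testing
condition. -/
theorem lintegral_tsum_mul_withDensity_le {p r s : ℝ} (hpr : p.HolderConjugate r) (hs : 1 < s)
    (hsr : s ≤ r) (μ : Measure Ω) (𝒢 : Filtration ℕ m0) [SigmaFiniteFiltration μ 𝒢]
    {α β : ℕ → Ω → ℝ≥0∞} (hα : ∀ n, Measurable[𝒢 n] (α n)) (hβ : ∀ n, Measurable[𝒢 n] (β n))
    {κ : ℝ≥0∞} (hκ : κ ≠ ∞) (hαβ : ∀ n, ∀ᵐ x ∂μ, ∑' k, α (n + k) x ≤ κ * β n x)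
    (hβα : ∀ n, ∀ᵐ x ∂μ, β n x ≤ κ * ∑' k, α (n + k) x) {W : Ω → ℝ≥0∞} (hW : Measurable W)
    (hWfin : ∀ n E, MeasurableSet[𝒢 n] E → μ E < ∞ → ∫⁻ x in E, W x ∂μ < ∞) {D : ℝ≥0∞}
    (htest : ∀ n E, MeasurableSet[𝒢 n] E → μ E < ∞ →
      (∫⁻ x in E, (∑' k, α (n + k) x * condLExp (𝒢 (n + k)) μ W x) ^ r ∂μ) ^ (1 / r)
        ≤ D * μ.withDensity W E ^ (1 / s))
    {f g : Ω → ℝ≥0∞} (hf : Measurable f) (hg : Measurable g) :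
    ∫⁻ x, (∑' n, α n x * condLExp (𝒢 n) μ f x) * g x ∂(μ.withDensity W)
      ≤ traceConst p r s κ * D * (∫⁻ x, f x ^ p ∂μ) ^ (1 / p)
          * (∫⁻ x, g x ^ s ∂(μ.withDensity W)) ^ (1 / s) := by
  have hp := hpr.lt
  have hr := hpr.symm.lt
  have hr0 : 0 < r := by linarith
  have hs0 : 0 < s := by linarith
  have hp0 : 0 < p := by linarith
  set ν := μ.withDensity W with hν
  have hνσ : SigmaFiniteFiltration ν 𝒢 :=
    ⟨fun n => sigmaFinite_trim_withDensity (𝒢.le n) μ (hWfin n)⟩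
  have hβ' : ∀ n, Measurable (β n) := fun n => (hβ n).mono (𝒢.le n) le_rfl
  have hα' : ∀ n, Measurable (α n) := fun n => (hα n).mono (𝒢.le n) le_rfl
  set b : ℕ → Ω → ℝ≥0∞ := fun n x => β n x * condLExp (𝒢 n) μ W x with hb
  have hbm : ∀ n, Measurable (b n) := fun n => (hβ' n).mul (measurable_condLExp' _ _ _)
  set u : ℕ → Ω → ℝ≥0∞ := fun n => condLExp (𝒢 n) ν g with hu
  have hum : ∀ n, Measurable[𝒢 n] (u n) := fun n => measurable_condLExp _ _ _
  have htest' : ∀ n E, MeasurableSet[𝒢 n] E → μ E < ∞ →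
      ∫⁻ x in E, (⨆ k, b (n + k) x) ^ r ∂μ
        ≤ (κ ^ r * (doobConst r * D ^ r)) * ν E ^ (r / s) := by
    intro n E hE hEfin
    refine (setLIntegral_iSup_mul_condLExp_rpow_le hr μ 𝒢 hα hβ hκ hβα hW n hE).trans ?_
    have h1 := htest n E hE hEfin
    rw [one_div, ENNReal.rpow_inv_le_iff hr0, ENNReal.mul_rpow_of_nonneg _ _ hr0.le,
      ← ENNReal.rpow_mul, one_div_mul_eq_div] at h1
    rw [mul_assoc, mul_assoc]
    gcongr
  have hmax : (∫⁻ x, (⨆ n, β n x * condLExp (𝒢 n) μ (fun x => W x * g x) x) ^ r ∂μ) ^ (1 / r)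
      ≤ 2 * κ * doobConst r ^ (1 / r) * (geomConst s * doobConst s) ^ (1 / s) * D
          * (∫⁻ x, g x ^ s ∂ν) ^ (1 / s) := by
    have h1 : ∫⁻ x, (⨆ n, β n x * condLExp (𝒢 n) μ (fun x => W x * g x) x) ^ r ∂μ
        = ∫⁻ x, (⨆ n, b n x * u n x) ^ r ∂μ := by
      refine lintegral_congr_ae ?_
      filter_upwards [ae_all_iff.2 fun n =>
        condLExp_withDensity_mul (𝒢.le n) μ hW hg] with x hx
      congr 1
      refine iSup_congr fun n => ?_
      rw [← hx n, hb, hu]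
      ring
    have h2 := lintegral_iSup_mul_rpow_le hs0 hsr μ ν 𝒢 hbm hum htest'
    have h3 := lintegral_iSup_condLExp_rpow_le hs ν 𝒢 hg
    rw [h1, one_div, ENNReal.rpow_inv_le_iff hr0]
    refine h2.trans ?_
    have h4 : (geomConst s * ∫⁻ x, (⨆ n, u n x) ^ s ∂ν) ^ (r / s)
        ≤ ((geomConst s * doobConst s) * ∫⁻ x, g x ^ s ∂ν) ^ (r / s) := by
      rw [mul_assoc]
      gcongr
    refine (mul_le_mul_right (mul_le_mul_right h4 _) _).trans (le_of_eq ?_)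
    simp only [ENNReal.mul_rpow_of_nonneg _ _ hr0.le,
      ENNReal.mul_rpow_of_nonneg _ _ (div_nonneg hr0.le hs0.le), ← ENNReal.rpow_mul,
      one_div_mul_eq_div, inv_mul_cancel₀ hr0.ne', ENNReal.rpow_one]
    ring
  have hswap : ∫⁻ x, (∑' n, α n x * condLExp (𝒢 n) μ f x) * g x ∂ν
      = ∫⁻ x, (∑' n, α n x * condLExp (𝒢 n) μ f x) * (W x * g x) ∂μ := by
    have hTm : Measurable fun x => ∑' n, α n x * condLExp (𝒢 n) μ f x :=
      Measurable.tsum fun n => (hα' n).mul (measurable_condLExp' _ _ _)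
    refine (lintegral_withDensity_eq_lintegral_mul μ hW (hTm.mul hg)).trans ?_
    refine lintegral_congr fun x => ?_
    simp only [Pi.mul_apply]
    ring
  rw [hswap]
  refine (lintegral_tsum_mul_condLExp_le μ 𝒢 hα hβ hκ hαβ (hW.mul hg)).trans ?_
  have hholder := ENNReal.lintegral_mul_le_Lp_mul_Lq μ hpr.symm
    (f := fun x => ⨆ n, β n x * condLExp (𝒢 n) μ (fun x => W x * g x) x)
    (g := fun x => ⨆ n, condLExp (𝒢 n) μ f x)
    (Measurable.iSup fun n => (hβ' n).mul (measurable_condLExp' _ _ _)).aemeasurable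
    (Measurable.iSup fun n => measurable_condLExp' _ _ _).aemeasurable
  have hdoob : (∫⁻ x, (⨆ n, condLExp (𝒢 n) μ f x) ^ p ∂μ) ^ (1 / p)
      ≤ doobConst p ^ (1 / p) * (∫⁻ x, f x ^ p ∂μ) ^ (1 / p) := by
    rw [← ENNReal.mul_rpow_of_nonneg _ _ (by positivity)]
    gcongr
    exact lintegral_iSup_condLExp_rpow_le hp μ 𝒢 hf
  refine (mul_le_mul_right (hholder.trans (mul_le_mul' hmax hdoob)) _).trans (le_of_eq ?_)
  rw [traceConst]
  ring

end FilteredMeasure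

namespace FilteredMeasure

variable {Ω : Type*}

/-! ### Real-valued conditional expectations -/

section RealCondExp

variable {m m0 : MeasurableSpace Ω}

/-- A function with finite integrals over the `m`-measurable sets of finite measure has an almost
everywhere finite conditional expectation. -/
theorem condLExp_lt_top_of_setLIntegral_lt_top (hm : m ≤ m0) (μ : Measure Ω)
    [SigmaFinite (μ.trim hm)] {X : Ω → ℝ≥0∞}
    (hX : ∀ E, MeasurableSet[m] E → μ E < ∞ → ∫⁻ x in E, X x ∂μ < ∞) :
    ∀ᵐ x ∂μ, condLExp m μ X x < ∞ := by
  have hT : MeasurableSet[m] {x | condLExp m μ X x = ∞} :=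
    measurable_condLExp m μ X (measurableSet_singleton _)
  have key := measure_le_of_forall_measure_lt_top hm μ μ 0 (c := 0) zero_le_one hT
    fun F hF hFm hFfin => by
      have h1 : ∞ * μ F ≤ ∫⁻ x in F, X x ∂μ := by
        rw [← setLIntegral_condLExp hm μ X hFm, ← setLIntegral_const]
        exact setLIntegral_mono' (hm _ hFm) fun x hx => (hF hx).ge
      have h2 := h1.trans_lt (hX F hFm hFfin)
      rcases eq_or_ne (μ F) 0 with h0 | h0
      · simp [h0]
      · rw [ENNReal.top_mul h0] at h2
        exact absurd h2 (lt_irrefl _)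
  rw [zero_mul, nonpos_iff_eq_zero] at key
  filter_upwards [measure_eq_zero_iff_ae_notMem.1 key] with x hx
  exact lt_top_iff_ne_top.2 hx

theorem setLIntegral_ofReal_lt_top {μ : Measure Ω} {f : Ω → ℝ}
    (hf : ∀ E, MeasurableSet[m] E → μ E < ∞ → IntegrableOn f E μ) (E : Set Ω)
    (hE : MeasurableSet[m] E) (hEfin : μ E < ∞) : ∫⁻ x in E, ENNReal.ofReal (f x) ∂μ < ∞ :=
  (hf E hE hEfin).lintegral_lt_top

theorem IsCondExp.ae_eq (hm : m ≤ m0) {μ : Measure Ω} [SigmaFinite (μ.trim hm)] {f g g' : Ω → ℝ}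
    (hg : IsCondExp m μ f g) (hg' : IsCondExp m μ f g') : g =ᵐ[μ] g' :=
  ae_eq_of_forall_setIntegral_eq_of_sigmaFinite' hm hg.integrableOn hg'.integrableOn
    (fun s hs hμs => (hg.setIntegral_eq s hs hμs).trans (hg'.setIntegral_eq s hs hμs).symm)
    hg.measurable.stronglyMeasurable.aestronglyMeasurable
    hg'.measurable.stronglyMeasurable.aestronglyMeasurable

/-- The real-valued conditional expectation is the difference of the conditional expectations of
the positive and of the negative part. -/
theorem cExp_ae_eq (hm : m ≤ m0) (μ : Measure Ω) [SigmaFinite (μ.trim hm)] {f : Ω → ℝ}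
    (hf : ∀ E, MeasurableSet[m] E → μ E < ∞ → IntegrableOn f E μ) :
    cExp m μ f =ᵐ[μ] fun x => (condLExp m μ (fun y => ENNReal.ofReal (f y)) x).toReal
      - (condLExp m μ (fun y => ENNReal.ofReal (-f y)) x).toReal := by
  have key : ∀ u : Ω → ℝ, (∀ E, MeasurableSet[m] E → μ E < ∞ → IntegrableOn u E μ) →
      ∀ E, MeasurableSet[m] E → μ E < ∞ →
      IntegrableOn (fun x => (condLExp m μ (fun y => ENNReal.ofReal (u y)) x).toReal) E μ ∧
      ∫ x in E, (condLExp m μ (fun y => ENNReal.ofReal (u y)) x).toReal ∂μ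
        = (∫⁻ x in E, ENNReal.ofReal (u x) ∂μ).toReal := by
    intro u hu E hE hEfin
    have hmeas : AEMeasurable (condLExp m μ (fun y => ENNReal.ofReal (u y))) (μ.restrict E) :=
      (measurable_condLExp' m μ _).aemeasurable
    have hfin : ∫⁻ x in E, condLExp m μ (fun y => ENNReal.ofReal (u y)) x ∂μ ≠ ∞ := by
      rw [setLIntegral_condLExp hm μ _ hE]
      exact (setLIntegral_ofReal_lt_top hu E hE hEfin).ne
    refine ⟨integrable_toReal_of_lintegral_ne_top hmeas hfin, ?_⟩
    rw [integral_toReal hmeas (ae_lt_top' hmeas hfin), setLIntegral_condLExp hm μ _ hE]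
  refine (isCondExp_cExp hm μ hf).ae_eq hm ⟨?_, fun E hE hEfin => ?_, fun E hE hEfin => ?_⟩
  · exact (measurable_condLExp m μ _).ennreal_toReal.sub (measurable_condLExp m μ _).ennreal_toReal
  · exact (key f hf E hE hEfin).1.sub
      (key (fun x => -f x) (fun E hE hEfin => (hf E hE hEfin).neg) E hE hEfin).1
  · have h1 := key f hf E hE hEfin
    have h2 := key (fun x => -f x) (fun E hE hEfin => (hf E hE hEfin).neg) E hE hEfin
    rw [integral_sub h1.1 h2.1, h1.2, h2.2,
      integral_eq_lintegral_pos_part_sub_lintegral_neg_part (hf E hE hEfin)]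

theorem enorm_cExp_le (hm : m ≤ m0) (μ : Measure Ω) [SigmaFinite (μ.trim hm)] {f : Ω → ℝ}
    (hf : ∀ E, MeasurableSet[m] E → μ E < ∞ → IntegrableOn f E μ) :
    ∀ᵐ x ∂μ, ‖cExp m μ f x‖ₑ ≤ condLExp m μ (fun y => ‖f y‖ₑ) x := by
  have h1 := condLExp_add_le (P := μ) (mΩ := m) (fun y => ENNReal.ofReal (f y))
    (fun y => ENNReal.ofReal (-f y))
  have h2 : ((fun y => ENNReal.ofReal (f y)) + fun y => ENNReal.ofReal (-f y))
      = fun y => ‖f y‖ₑ := by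
    funext y
    rw [Pi.add_apply, Real.enorm_eq_ofReal_abs]
    rcases le_total 0 (f y) with h | h
    · rw [abs_of_nonneg h, ENNReal.ofReal_of_nonpos (neg_nonpos.2 h), add_zero]
    · rw [abs_of_nonpos h, ENNReal.ofReal_of_nonpos h, zero_add]
  rw [h2] at h1
  filter_upwards [h1, cExp_ae_eq hm μ hf] with x hx hx'
  rw [hx']
  refine (enorm_sub_le).trans (le_trans ?_ hx)
  have h3 : ∀ a : ℝ≥0∞, ‖a.toReal‖ₑ ≤ a := fun a => by
    rw [Real.enorm_eq_ofReal ENNReal.toReal_nonneg]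
    exact ENNReal.ofReal_toReal_le
  exact add_le_add (h3 _) (h3 _)

theorem ofReal_cExp_ae_eq (hm : m ≤ m0) (μ : Measure Ω) [SigmaFinite (μ.trim hm)] {f : Ω → ℝ}
    (hf : ∀ E, MeasurableSet[m] E → μ E < ∞ → IntegrableOn f E μ) (hf0 : 0 ≤ᵐ[μ] f) :
    ∀ᵐ x ∂μ, 0 ≤ cExp m μ f x ∧
      ENNReal.ofReal (cExp m μ f x) = condLExp m μ (fun y => ENNReal.ofReal (f y)) x := by
  have h1 : condLExp m μ (fun y => ENNReal.ofReal (-f y)) =ᵐ[μ] 0 := by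
    rw [← condLExp_zero (mΩ := m) μ]
    refine condLExp_congr_ae ?_
    filter_upwards [hf0] with x hx
    exact ENNReal.ofReal_of_nonpos (neg_nonpos.2 hx)
  filter_upwards [h1, cExp_ae_eq hm μ hf,
    condLExp_lt_top_of_setLIntegral_lt_top hm μ (setLIntegral_ofReal_lt_top hf)] with x h1 h2 h3
  rw [h2, h1]
  simp [ENNReal.ofReal_toReal h3.ne]

theorem integrableOn_of_memLp {μ : Measure Ω} {p : ℝ} (hp : 1 ≤ p) {f : Ω → ℝ}
    (hf : MemLp f (ENNReal.ofReal p) μ) {E : Set Ω} (hE : μ E < ∞) : IntegrableOn f E μ := by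
  have : IsFiniteMeasure (μ.restrict E) := ⟨by simpa using hE⟩
  refine (hf.restrict E).integrable ?_
  rw [← ENNReal.ofReal_one]
  exact ENNReal.ofReal_le_ofReal hp

end RealCondExp

/-! ### Tails of sequences indexed by the integers -/

/-- The enumeration `k ↦ i + k` of the integers `j ≥ i`. -/
def natEquivIci (i : ℤ) : ℕ ≃ Set.Ici i where
  toFun k := ⟨i + k, Set.mem_Ici.2 (by omega)⟩
  invFun j := ((j : ℤ) - i).toNat
  left_inv k := by simp
  right_inv j := by
    have h : i ≤ (j : ℤ) := j.2
    ext
    simp [Int.toNat_of_nonneg (sub_nonneg.2 h)]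

theorem tsum_Ici_eq {M : Type*} [AddCommMonoid M] [TopologicalSpace M] (i : ℤ) (a : ℤ → M) :
    ∑' j : Set.Ici i, a j = ∑' k : ℕ, a (i + k) :=
  ((natEquivIci i).tsum_eq fun j : Set.Ici i => a j).symm

theorem ofReal_tailSum {α : ℤ → Ω → ℝ} {i : ℤ} {x : Ω} (h0 : ∀ j, 0 ≤ α j x)
    (hs : Summable fun j : Set.Ici i => α (j : ℤ) x) :
    ENNReal.ofReal (tailSum α i x) = ∑' k : ℕ, ENNReal.ofReal (α (i + k) x) := by
  rw [tailSum, ENNReal.ofReal_tsum_of_nonneg (fun j : Set.Ici i => h0 j) hs]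
  exact tsum_Ici_eq i fun j => ENNReal.ofReal (α j x)

/-- A series of nonnegative terms over the integers is the supremum of its tails. -/
theorem tsum_int_le_of_forall_tail_le {a : ℤ → ℝ≥0∞} {C : ℝ≥0∞}
    (h : ∀ i : ℤ, ∑' k : ℕ, a (i + k) ≤ C) : ∑' i, a i ≤ C := by
  rw [ENNReal.tsum_eq_iSup_sum]
  refine iSup_le fun s => ?_
  obtain ⟨i, hi⟩ := s.bddBelow
  refine le_trans ?_ (h i)
  rw [← tsum_Ici_eq i a, ← Finset.tsum_subtype]
  exact ENNReal.tsum_mono_subtype a fun j hj => hi hj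

/-- The filtration `ℱ_i, ℱ_{i+1}, …`. -/
noncomputable def tailFiltration {m0 : MeasurableSpace Ω} (ℱ : Filtration ℤ m0) (i : ℤ) :
    Filtration ℕ m0 :=
  subFiltration ℱ ⟨fun k => i + k, fun a b h => by simpa using h⟩

instance {m0 : MeasurableSpace Ω} (μ : Measure Ω) (ℱ : Filtration ℤ m0)
    [SigmaFiniteFiltration μ ℱ] (i : ℤ) : SigmaFiniteFiltration μ (tailFiltration ℱ i) :=
  inferInstanceAs (SigmaFiniteFiltration μ (subFiltration ℱ _))

/-! ### The two implications -/

variable [m0 : MeasurableSpace Ω] {μ : Measure Ω} {ℱ : Filtration ℤ m0}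
  {α : ℤ → Ω → ℝ} {w : Ω → ℝ} {p q κ C : ℝ}

/-- For nonnegative `f`, the terms of the series `T_α f` in terms of conditional expectations in
`ℝ≥0∞`. -/
theorem ofReal_mul_cExp_ae_eq [SigmaFiniteFiltration μ ℱ] (hα : ∀ i x, 0 ≤ α i x) {f : Ω → ℝ}
    (hf : ∀ i, ∀ E, MeasurableSet[ℱ i] E → μ E < ∞ → IntegrableOn f E μ) (hf0 : 0 ≤ᵐ[μ] f) :
    ∀ᵐ x ∂μ, ∀ i, 0 ≤ cExp (ℱ i) μ f x ∧ ENNReal.ofReal (α i x * cExp (ℱ i) μ f x)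
      = ENNReal.ofReal (α i x) * condLExp (ℱ i) μ (fun y => ENNReal.ofReal (f y)) x := by
  filter_upwards [ae_all_iff.2 fun i => ofReal_cExp_ae_eq (ℱ.le i) μ (hf i) hf0] with x hx i
  exact ⟨(hx i).1, by rw [ENNReal.ofReal_mul (hα i x), (hx i).2]⟩

theorem conjExponent_le_conjExponent (hp : 1 < p) (hpq : p ≤ q) :
    q.conjExponent ≤ p.conjExponent := by
  rw [Real.conjExponent, Real.conjExponent, div_le_div_iff₀ (by linarith) (by linarith)]
  linarith

theorem eLpNorm_ofReal_eq (hp : 0 < p) (ν : Measure Ω) (f : Ω → ℝ) :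
    eLpNorm f (ENNReal.ofReal p) ν = (∫⁻ x, ‖f x‖ₑ ^ p ∂ν) ^ (1 / p) := by
  rw [eLpNorm_eq_lintegral_rpow_enorm_toReal (by simpa using hp) ENNReal.ofReal_ne_top,
    ENNReal.toReal_ofReal hp.le]

/-- The bilinear trace inequality for the positive operator indexed by `ℤ`. -/
theorem TestingCondition.lintegral_tsum_mul_le [SigmaFiniteFiltration μ ℱ] (hp : 1 < p)
    (hpq : p ≤ q) (hκ : 0 < κ) (hα : TailCondition μ ℱ α κ) (hw : IsWeight μ ℱ w)
    (htest : TestingCondition μ ℱ α w p q C) {f g : Ω → ℝ≥0∞} (hf : Measurable f)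
    (hg : Measurable g) :
    ∫⁻ x, (∑' i, ENNReal.ofReal (α i x) * condLExp (ℱ i) μ f x) * g x ∂(weighted μ w)
      ≤ traceConst p p.conjExponent q.conjExponent (ENNReal.ofReal κ) * ENNReal.ofReal C
          * (∫⁻ x, f x ^ p ∂μ) ^ (1 / p)
          * (∫⁻ x, g x ^ q.conjExponent ∂(weighted μ w)) ^ (1 / q.conjExponent) := by
  have hq : 1 < q := hp.trans_le hpq
  have hpr := Real.HolderConjugate.conjExponent hp
  have hqs := Real.HolderConjugate.conjExponent hq
  have haw : AEMeasurable (fun x => ENNReal.ofReal (w x)) μ :=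
    hw.aestronglyMeasurable.aemeasurable.ennreal_ofReal
  set W := haw.mk _ with hWdef
  have hWm : Measurable W := haw.measurable_mk
  have hWeq : (fun x => ENNReal.ofReal (w x)) =ᵐ[μ] W := haw.ae_eq_mk
  have hν : weighted μ w = μ.withDensity W := withDensity_congr_ae hWeq
  have hWfin : ∀ i E, MeasurableSet[ℱ i] E → μ E < ∞ → ∫⁻ x in E, W x ∂μ < ∞ := by
    intro i E hE hEfin
    rw [← lintegral_congr_ae (ae_restrict_of_ae hWeq)]
    exact setLIntegral_ofReal_lt_top (hw.integrableOn i) E hE hEfin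
  have hαm : ∀ i, Measurable[ℱ i] fun x => ENNReal.ofReal (α i x) := fun i =>
    (hα.measurable i).ennreal_ofReal
  have hterm : ∀ i, Measurable fun x =>
      ENNReal.ofReal (α i x) * condLExp (ℱ i) μ f x := fun i =>
    ((hαm i).mono (ℱ.le i) le_rfl).mul (measurable_condLExp' _ _ _)
  set β : ℤ → Ω → ℝ≥0∞ := fun i =>
    condLExp (ℱ i) μ (fun x => ENNReal.ofReal (tailSum α i x)) with hβ
  have htail : ∀ i, ∀ᵐ x ∂μ, ENNReal.ofReal (cExp (ℱ i) μ (tailSum α i) x) = β i x ∧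
      ENNReal.ofReal (tailSum α i x) = ∑' k : ℕ, ENNReal.ofReal (α (i + k) x) := by
    intro i
    filter_upwards [hα.summable i, ofReal_cExp_ae_eq (ℱ.le i) μ ((hα.isWeight i).integrableOn i)
      (hα.isWeight i).nonneg] with x h1 h2
    exact ⟨h2.2, ofReal_tailSum (fun j => hα.nonneg j x) h1⟩
  have hαβ : ∀ i, ∀ᵐ x ∂μ,
      ∑' k : ℕ, ENNReal.ofReal (α (i + k) x) ≤ ENNReal.ofReal κ * β i x := by
    intro i
    filter_upwards [htail i, hα.lower i] with x h1 h2
    rw [← h1.1, ← h1.2, ← ENNReal.ofReal_mul hκ.le]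
    exact ENNReal.ofReal_le_ofReal ((inv_mul_le_iff₀ hκ).1 h2)
  have hβα : ∀ i, ∀ᵐ x ∂μ,
      β i x ≤ ENNReal.ofReal κ * ∑' k : ℕ, ENNReal.ofReal (α (i + k) x) := by
    intro i
    filter_upwards [htail i, hα.upper i] with x h1 h2
    rw [← h1.1, ← h1.2, ← ENNReal.ofReal_mul hκ.le]
    exact ENNReal.ofReal_le_ofReal h2
  have hw' : ∀ᵐ x ∂μ, ∀ i, ENNReal.ofReal (α i x * cExp (ℱ i) μ w x)
      = ENNReal.ofReal (α i x) * condLExp (ℱ i) μ W x := by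
    filter_upwards [ofReal_mul_cExp_ae_eq hα.nonneg hw.integrableOn hw.nonneg,
      ae_all_iff.2 fun i => condLExp_congr_ae (mΩ := ℱ i) hWeq] with x h1 h2 i
    rw [(h1 i).2, h2 i]
  have htest' : ∀ i E, MeasurableSet[ℱ i] E → μ E < ∞ →
      (∫⁻ x in E, (∑' k : ℕ, ENNReal.ofReal (α (i + k) x) * condLExp (ℱ (i + k)) μ W x)
        ^ p.conjExponent ∂μ) ^ (1 / p.conjExponent)
        ≤ ENNReal.ofReal C * μ.withDensity W E ^ (1 / q.conjExponent) := by
    intro i E hE hEfin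
    have h := htest i E hE hEfin
    rw [hν] at h
    refine le_trans (le_of_eq ?_) h
    congr 1
    refine lintegral_congr_ae (ae_restrict_of_ae ?_)
    filter_upwards [hw'] with x hx
    congr 1
    rw [tsum_Ici_eq i fun j => ENNReal.ofReal (α j x * cExp (ℱ j) μ w x)]
    exact tsum_congr fun k => (hx (i + k)).symm
  have htermg : ∀ i, Measurable fun x =>
      ENNReal.ofReal (α i x) * condLExp (ℱ i) μ f x * g x := fun i => (hterm i).mul hg
  rw [hν]
  simp_rw [← ENNReal.tsum_mul_right]
  rw [lintegral_tsum fun i => (htermg i).aemeasurable]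
  refine tsum_int_le_of_forall_tail_le fun i => ?_
  rw [← lintegral_tsum fun k : ℕ => (htermg (i + k)).aemeasurable]
  have h := lintegral_tsum_mul_withDensity_le hpr hqs.symm.lt
    (conjExponent_le_conjExponent hp hpq) μ (tailFiltration ℱ i)
    (α := fun k x => ENNReal.ofReal (α (i + k) x)) (β := fun k => β (i + k))
    (fun k => hαm (i + k)) (fun k => measurable_condLExp _ _ _) (κ := ENNReal.ofReal κ)
    ENNReal.ofReal_ne_top
    (fun n => by simpa only [Nat.cast_add, add_assoc] using hαβ (i + n))
    (fun n => by simpa only [Nat.cast_add, add_assoc] using hβα (i + n)) hWm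
    (fun n => hWfin (i + n)) (D := ENNReal.ofReal C)
    (fun n E hE hEfin => by
      have := htest' (i + n) E hE hEfin
      simp only [add_assoc, ← Nat.cast_add] at this
      exact this) hf hg
  simp_rw [← ENNReal.tsum_mul_right] at h
  exact h

/-- The testing condition implies the trace inequality. -/
theorem TestingCondition.traceInequality [SigmaFiniteFiltration μ ℱ] (hp : 1 < p) (hpq : p ≤ q)
    (hκ : 0 < κ) (hα : TailCondition μ ℱ α κ) (hw : IsWeight μ ℱ w) {K : ℝ} (hK : 0 ≤ K)
    (hKc : traceConst p p.conjExponent q.conjExponent (ENNReal.ofReal κ) ≤ ENNReal.ofReal K)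
    (htest : TestingCondition μ ℱ α w p q C) : TraceInequality μ ℱ α w p q (K * C) := by
  intro f hf
  have hq : 1 < q := hp.trans_le hpq
  have hp0 : 0 < p := by linarith
  have hq0 : 0 < q := by linarith
  have hqs := Real.HolderConjugate.conjExponent hq
  have hloc : ∀ i, ∀ E, MeasurableSet[ℱ i] E → μ E < ∞ → IntegrableOn f E μ :=
    fun i E _ hEfin => integrableOn_of_memLp hp.le hf hEfin
  have : SigmaFinite (weighted μ w) :=
    have : SigmaFinite ((weighted μ w).trim (ℱ.le 0)) := sigmaFinite_trim_withDensity (ℱ.le 0) μ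
      (setLIntegral_ofReal_lt_top (hw.integrableOn 0))
    SigmaFinite.of_trim (μ := weighted μ w) (ℱ.le 0)
  have haf : AEMeasurable (fun x => ‖f x‖ₑ) μ := hf.1.enorm
  set φ := haf.mk _ with hφdef
  have hφm : Measurable φ := haf.measurable_mk
  have hφeq : (fun x => ‖f x‖ₑ) =ᵐ[μ] φ := haf.ae_eq_mk
  set H : Ω → ℝ≥0∞ := fun x => ∑' i, ENNReal.ofReal (α i x) * condLExp (ℱ i) μ φ x with hH
  have hHm : Measurable H := Measurable.tsum fun i =>
    ((hα.measurable i).mono (ℱ.le i) le_rfl).ennreal_ofReal.mul (measurable_condLExp' _ _ _)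
  have hnorm : (∫⁻ x, φ x ^ p ∂μ) ^ (1 / p) = eLpNorm f (ENNReal.ofReal p) μ := by
    rw [eLpNorm_ofReal_eq hp0]
    congr 1
    refine lintegral_congr_ae ?_
    filter_upwards [hφeq] with x hx
    rw [hx]
  have hbound : (∫⁻ x, H x ^ q ∂(weighted μ w)) ^ (1 / q)
      ≤ ENNReal.ofReal (K * C) * eLpNorm f (ENNReal.ofReal p) μ := by
    refine lintegral_rpow_le_of_forall_pairing _ hqs hHm fun g hg _ _ => ?_
    refine (htest.lintegral_tsum_mul_le hp hpq hκ hα hw hφm hg).trans ?_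
    rw [hnorm, ENNReal.ofReal_mul hK]
    gcongr
  have hle : ∀ᵐ x ∂(weighted μ w), ∑' i, ‖α i x * cExp (ℱ i) μ f x‖ₑ ≤ H x := by
    refine (withDensity_absolutelyContinuous μ _).ae_le ?_
    filter_upwards [ae_all_iff.2 fun i => enorm_cExp_le (ℱ.le i) μ (hloc i),
      ae_all_iff.2 fun i => condLExp_congr_ae (mΩ := ℱ i) hφeq] with x h1 h2
    refine ENNReal.tsum_le_tsum fun i => ?_
    rw [enorm_mul, Real.enorm_eq_ofReal (hα.nonneg i x), ← h2 i]
    gcongr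
    exact h1 i
  have hfin : ∀ᵐ x ∂(weighted μ w), H x < ∞ := by
    have h1 : ∫⁻ x, H x ^ q ∂(weighted μ w) ≠ ∞ := by
      intro htop
      rw [htop, ENNReal.top_rpow_of_pos (by positivity), top_le_iff] at hbound
      exact ENNReal.mul_ne_top ENNReal.ofReal_ne_top hf.2.ne hbound
    filter_upwards [ae_lt_top (hHm.pow_const q) h1] with x hx
    exact (ENNReal.rpow_lt_top_iff_of_pos hq0).1 hx
  refine ⟨?_, ?_⟩
  · filter_upwards [hle, hfin] with x h1 h2
    exact Summable.of_enorm (h1.trans_lt h2).ne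
  · refine le_trans ?_ hbound
    rw [eLpNorm_ofReal_eq hq0]
    refine ENNReal.rpow_le_rpow (lintegral_mono_ae ?_) (by positivity)
    filter_upwards [hle] with x hx
    exact ENNReal.rpow_le_rpow (enorm_tsum_le_tsum_enorm.trans hx) hq0.le

/-- The trace inequality implies the testing condition, by duality: the integral over `E` of the
tail of the positive operator applied to `w`, against `g`, is at most the integral over `E` of
`T_α (1_E g)` with respect to `w dμ`. -/
theorem TraceInequality.testingCondition [SigmaFiniteFiltration μ ℱ] (hp : 1 < p) (hq : 1 < q)
    (hα : ∀ i, Measurable[ℱ i] (α i)) (hα0 : ∀ i x, 0 ≤ α i x) (hw : IsWeight μ ℱ w)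
    (htrace : TraceInequality μ ℱ α w p q C) : TestingCondition μ ℱ α w p q C := by
  intro i E hE hEfin
  have hp0 : 0 < p := by linarith
  have hq0 : 0 < q := by linarith
  have hpr := Real.HolderConjugate.conjExponent hp
  have hqs := Real.HolderConjugate.conjExponent hq
  have hE' := ℱ.le i _ hE
  have haw : AEMeasurable (fun x => ENNReal.ofReal (w x)) μ :=
    hw.aestronglyMeasurable.aemeasurable.ennreal_ofReal
  set W := haw.mk _ with hWdef
  have hWm : Measurable W := haw.measurable_mk
  have hWeq : (fun x => ENNReal.ofReal (w x)) =ᵐ[μ] W := haw.ae_eq_mk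
  have hν : weighted μ w = μ.withDensity W := withDensity_congr_ae hWeq
  have hαm : ∀ j, Measurable[ℱ j] fun x => ENNReal.ofReal (α j x) := fun j =>
    (hα j).ennreal_ofReal
  have hαm' : ∀ j, Measurable fun x => ENNReal.ofReal (α j x) := fun j =>
    (hαm j).mono (ℱ.le j) le_rfl
  set G : Ω → ℝ≥0∞ := fun x =>
    ∑' j : Set.Ici i, ENNReal.ofReal (α j x) * condLExp (ℱ j) μ W x with hG
  have hGm : Measurable G := Measurable.tsum fun j =>
    (hαm' j).mul (measurable_condLExp' _ _ _)
  have hGeq : ∫⁻ x in E, (∑' j : Set.Ici i,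
        ENNReal.ofReal (α (j : ℤ) x * cExp (ℱ (j : ℤ)) μ w x)) ^ p.conjExponent ∂μ
      = ∫⁻ x in E, G x ^ p.conjExponent ∂μ := by
    refine lintegral_congr_ae (ae_restrict_of_ae ?_)
    filter_upwards [ofReal_mul_cExp_ae_eq hα0 hw.integrableOn hw.nonneg,
      ae_all_iff.2 fun i => condLExp_congr_ae (mΩ := ℱ i) hWeq] with x h1 h2
    congr 1
    refine tsum_congr fun j => ?_
    rw [(h1 j).2, h2 j]
  rw [hGeq]
  have : IsFiniteMeasure (μ.restrict E) := ⟨by simpa using hEfin⟩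
  refine lintegral_rpow_le_of_forall_pairing (μ.restrict E) hpr.symm hGm fun g hg hgfin hgp => ?_
  set gE : Ω → ℝ≥0∞ := E.indicator g with hgE
  have hgEm : Measurable gE := hg.indicator hE'
  have hgEfin : ∀ x, gE x ≠ ∞ := fun x => by
    by_cases hx : x ∈ E <;> simp [hgE, hx, hgfin]
  set f : Ω → ℝ := fun x => (gE x).toReal with hf
  have hf0 : ∀ x, 0 ≤ f x := fun x => ENNReal.toReal_nonneg
  have hfg : ∀ x, ENNReal.ofReal (f x) = gE x := fun x => ENNReal.ofReal_toReal (hgEfin x)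
  have hfnorm : eLpNorm f (ENNReal.ofReal p) μ = (∫⁻ x in E, g x ^ p ∂μ) ^ (1 / p) := by
    rw [eLpNorm_ofReal_eq hp0, ← lintegral_indicator hE']
    congr 1
    refine lintegral_congr fun x => ?_
    rw [Real.enorm_eq_ofReal (hf0 x), hfg]
    by_cases hx : x ∈ E <;> simp [hgE, hx, hp0]
  have hfLp : MemLp f (ENNReal.ofReal p) μ := by
    refine ⟨hgEm.ennreal_toReal.aestronglyMeasurable, ?_⟩
    rw [hfnorm]
    exact ENNReal.rpow_lt_top_of_nonneg (by positivity) hgp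
  obtain ⟨hsum, hbound⟩ := htrace f hfLp
  set T : Ω → ℝ≥0∞ := fun x => ∑' j, ENNReal.ofReal (α j x) * condLExp (ℱ j) μ gE x with hT
  have hTm : Measurable T := Measurable.tsum fun j =>
    (hαm' j).mul (measurable_condLExp' _ _ _)
  have hTeq : ∀ᵐ x ∂(weighted μ w), ‖posOp μ ℱ α f x‖ₑ = T x := by
    have h1 : ∀ᵐ x ∂(weighted μ w), ∀ j, 0 ≤ cExp (ℱ j) μ f x ∧
        ENNReal.ofReal (α j x * cExp (ℱ j) μ f x)
          = ENNReal.ofReal (α j x) * condLExp (ℱ j) μ (fun y => ENNReal.ofReal (f y)) x :=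
      (withDensity_absolutelyContinuous μ _).ae_le (ofReal_mul_cExp_ae_eq hα0
        (fun j E _ hEfin => integrableOn_of_memLp hp.le hfLp hEfin)
        (Filter.Eventually.of_forall hf0))
    filter_upwards [hsum, h1] with x hx1 hx2
    have hnn : ∀ j, 0 ≤ α j x * cExp (ℱ j) μ f x := fun j => mul_nonneg (hα0 j x) (hx2 j).1
    rw [posOp, Real.enorm_eq_ofReal (tsum_nonneg hnn), ENNReal.ofReal_tsum_of_nonneg hnn hx1]
    refine tsum_congr fun j => ?_
    rw [(hx2 j).2]
    simp only [hfg]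
  have hpair : ∫⁻ x in E, G x * g x ∂μ ≤ ∫⁻ x in E, T x ∂(weighted μ w) := by
    have hterm : ∀ j : Set.Ici i,
        ∫⁻ x, ENNReal.ofReal (α j x) * condLExp (ℱ j) μ W x * gE x ∂μ
          = ∫⁻ x in E, ENNReal.ofReal (α j x) * condLExp (ℱ j) μ gE x * W x ∂μ := by
      intro j
      have hEj : MeasurableSet[ℱ j] E := ℱ.mono j.2 _ hE
      have hy := ((hαm j).mul (measurable_condLExp (ℱ (j : ℤ)) μ W)).indicator hEj
      have hy' := ((hαm j).mul (measurable_condLExp (ℱ (j : ℤ)) μ gE)).indicator hEj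
      have e1 := lintegral_mul_condLExp (ℱ.le j) μ hy hgEm
      have e2 := lintegral_mul_condLExp (ℱ.le j) μ hy' hWm
      rw [← lintegral_indicator hE']
      calc _ = ∫⁻ x, E.indicator ((fun x => ENNReal.ofReal (α j x))
                * condLExp (ℱ (j : ℤ)) μ W) x * gE x ∂μ := by
            refine lintegral_congr fun x => ?_
            by_cases hx : x ∈ E <;> simp [hgE, hx]
        _ = _ := e1.symm
        _ = _ := by
            refine lintegral_congr fun x => ?_
            by_cases hx : x ∈ E
            · simp only [Set.indicator_of_mem hx, Pi.mul_apply]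
              exact mul_right_comm _ _ _
            · simp [hx]
        _ = _ := e2
        _ = _ := by
            refine lintegral_congr fun x => ?_
            by_cases hx : x ∈ E <;> simp [hx]
    calc ∫⁻ x in E, G x * g x ∂μ
        = ∫⁻ x, ∑' j : Set.Ici i,
            ENNReal.ofReal (α j x) * condLExp (ℱ j) μ W x * gE x ∂μ := by
          rw [← lintegral_indicator hE']
          refine lintegral_congr fun x => ?_
          rw [ENNReal.tsum_mul_right]
          by_cases hx : x ∈ E <;> simp [hG, hgE, hx]
      _ = ∑' j : Set.Ici i,
            ∫⁻ x in E, ENNReal.ofReal (α j x) * condLExp (ℱ j) μ gE x * W x ∂μ := by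
          exact (lintegral_tsum fun j =>
            (((hαm' _).mul (measurable_condLExp' _ _ _)).mul hgEm).aemeasurable).trans
              (tsum_congr hterm)
      _ = ∫⁻ x in E, (∑' j : Set.Ici i,
            ENNReal.ofReal (α j x) * condLExp (ℱ j) μ gE x) * W x ∂μ := by
          simp_rw [← ENNReal.tsum_mul_right]
          exact (lintegral_tsum fun j =>
            (((hαm' _).mul (measurable_condLExp' _ _ _)).mul hWm).aemeasurable).symm
      _ ≤ ∫⁻ x in E, W x * T x ∂μ := by
          refine lintegral_mono fun x => ?_
          rw [mul_comm]
          refine mul_le_mul_right ?_ _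
          exact ENNReal.tsum_comp_le_tsum_of_injective Subtype.val_injective
            fun j => ENNReal.ofReal (α j x) * condLExp (ℱ j) μ gE x
      _ = ∫⁻ x in E, T x ∂(weighted μ w) := by
          rw [hν, setLIntegral_withDensity_eq_setLIntegral_mul μ hWm hTm hE']
          rfl
  have hholder : ∫⁻ x in E, T x ∂(weighted μ w)
      ≤ (∫⁻ x, T x ^ q ∂(weighted μ w)) ^ (1 / q)
        * weighted μ w E ^ (1 / q.conjExponent) := by
    have h := ENNReal.lintegral_mul_le_Lp_mul_Lq ((weighted μ w).restrict E) hqs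
      hTm.aemeasurable (aemeasurable_const (b := (1 : ℝ≥0∞)))
    simp only [Pi.mul_apply, mul_one, ENNReal.one_rpow, lintegral_const, one_mul,
      Measure.restrict_apply_univ] at h
    refine h.trans ?_
    gcongr
    exact Measure.restrict_le_self
  have hTnorm : (∫⁻ x, T x ^ q ∂(weighted μ w)) ^ (1 / q)
      = eLpNorm (posOp μ ℱ α f) (ENNReal.ofReal q) (weighted μ w) := by
    rw [eLpNorm_ofReal_eq hq0]
    congr 1
    refine lintegral_congr_ae ?_
    filter_upwards [hTeq] with x hx
    rw [hx]
  rw [← hTnorm, hfnorm] at hbound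
  refine (hpair.trans hholder).trans ((mul_le_mul_left hbound _).trans (le_of_eq ?_))
  ring

end FilteredMeasure

theorem theorem1p1 (p q κ : ℝ) (hp : 1 < p) (hpq : p ≤ q) (hκ : 0 < κ) :
    ∃ K : ℝ, 0 < K ∧
      ∀ (Ω : Type*) [m0 : MeasurableSpace Ω] (μ : Measure Ω) (ℱ : Filtration ℤ m0)
        [SigmaFiniteFiltration μ ℱ] (α : ℤ → Ω → ℝ) (w : Ω → ℝ),
        TailCondition μ ℱ α κ → IsWeight μ ℱ w →
        ((∃ C₁ : ℝ, 0 < C₁ ∧ TraceInequality μ ℱ α w p q C₁) ↔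
          ∃ C₂ : ℝ, 0 < C₂ ∧ TestingCondition μ ℱ α w p q C₂) ∧
        leastConst (TraceInequality μ ℱ α w p q)
          ≤ ENNReal.ofReal K * leastConst (TestingCondition μ ℱ α w p q) ∧
        leastConst (TestingCondition μ ℱ α w p q)
          ≤ ENNReal.ofReal K * leastConst (TraceInequality μ ℱ α w p q) := by
  have hq : 1 < q := hp.trans_le hpq
  set c := traceConst p p.conjExponent q.conjExponent (ENNReal.ofReal κ) with hc
  have hc_top : c ≠ ∞ := traceConst_ne_top hp (Real.HolderConjugate.conjExponent hp).symm.lt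
    (Real.HolderConjugate.conjExponent hq).symm.lt ENNReal.ofReal_ne_top
  set K : ℝ := max 1 c.toReal with hK
  have hK1 : 1 ≤ K := le_max_left _ _
  have hK0 : 0 < K := by linarith
  have hKc : c ≤ ENNReal.ofReal K := by
    rw [← ENNReal.ofReal_toReal hc_top]
    exact ENNReal.ofReal_le_ofReal (le_max_right _ _)
  refine ⟨K, hK0, fun Ω m0 μ ℱ _ α w hα hw => ?_⟩
  have h1 : ∀ {C}, TestingCondition μ ℱ α w p q C → TraceInequality μ ℱ α w p q (K * C) :=
    fun h => h.traceInequality hp hpq hκ hα hw hK0.le hKc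
  have h2 : ∀ {C}, TraceInequality μ ℱ α w p q C → TestingCondition μ ℱ α w p q C :=
    fun h => h.testingCondition hp hq hα.measurable hα.nonneg hw
  refine ⟨⟨fun ⟨C, hC, h⟩ => ⟨C, hC, h2 h⟩, fun ⟨C, hC, h⟩ => ⟨K * C, by positivity, h1 h⟩⟩,
    ?_, ?_⟩
  · simp only [leastConst]
    rw [ENNReal.mul_iInf_of_ne (by simpa using hK0) ENNReal.ofReal_ne_top]
    refine le_iInf fun C => ?_
    rw [ENNReal.mul_iInf_of_ne (by simpa using hK0) ENNReal.ofReal_ne_top]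
    refine le_iInf fun ⟨hC, h⟩ => ?_
    rw [← ENNReal.ofReal_mul hK0.le]
    exact iInf₂_le (K * C) ⟨by positivity, h1 h⟩
  · refine le_trans ?_ (le_mul_of_one_le_left zero_le (by simpa using hK1))
    exact le_iInf₂ fun C hC => iInf₂_le C ⟨hC.1, h2 hC.2⟩
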